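/- Let $d\ge 1$, $n\ge 0$ be integers and $\lambda\in\mathbb R$. Identify densities $s(x)|Dx|^\mu$ of weight $\mu$ on $\mathbb R^d$ with smooth functions $s$, so that a vector field $X=X^i\partial_i$ acts on them by the Lie derivative $\mathcal L^\mu_X=X^i\partial_i+\mu\,\partial_iX^i$. Let $\mathcal D^{(n)}_\mu$ be the space of differential operators of order $\le n$ with smooth coefficients acting on densities of weight $\mu$, and let $\hat{\mathcal D}^{(n)}$ be the space of operators of weight $0$ and order $\le n$ on the algebra of densities, i.e. finite sums of $a(x)\,\hat w^j\partial_{i_1}\cdots\partial_{i_k}$ with $a$ smooth and $j+k\le n$, where $\hat w$ is the weight operator; such an operator is identified with the pencil $\mu\mapsto\hat\Delta|_{\hat w=\mu}$. Let $\mathrm{proj}(\mathbb R^d)$ be the Lie algebra spanned by $\partial_i$, $x^k\partial_i$ and $x^k\sum_i x^i\partial_i$. A regular $\mathrm{proj}$-equivariant pencil lifting of $\mathcal D^{(n)}_\lambda$ is a linear map $\hat\Pi:\mathcal D^{(n)}_\lambda\to\hat{\mathcal D}^{(n)}$ such that $\hat\Pi(\Delta)|_{\hat w=\lambda}=\Delta$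 and $\hat\Pi(\mathrm{ad}_X\Delta)=\mathrm{ad}_X\hat\Pi(\Delta)$ for all $\Delta\in\mathcal D^{(n)}_\lambda$ and $X\in\mathrm{proj}(\mathbb R^d)$, where $\mathrm{ad}_X\Delta=\mathcal L_X\circ\Delta-\Delta\circ\mathcal L_X$. For a symbol $S=S^{i_1\dots i_k}(x)\xi_{i_1}\cdots\xi_{i_k}$ of rank $k$ put $$Q_\mu(S)=\sum_{r=0}^k\binom kr\prod_{j=1}^r\frac{(d+1)\mu+k-j}{d+2k-j}\;\bigl(\partial_{j_1}\cdots\partial_{j_r}S^{j_1\dots j_ri_1\dots i_{k-r}}\bigr)\,\partial_{i_1}\cdots\partial_{i_{k-r}} ,$$ and extend $Q_\mu$ linearly to symbols of rank $\le n$. For each $\Delta\in\mathcal D^{(n)}_\lambda$ define $\Delta_n,\dots,\Delta_0$ inductively: $\Delta_k$ is $Q_\lambda$ applied to the rank-$k$ principal symbol of $\Delta-\Delta_n-\dots-\Delta_{k+1}$. Let $\sigma_\lambda(\Delta)$ be the sum of the principal symbols so obtained, and define the DLO-pencil lifting by $\hat\Pi^{\rm DLO}_\lambda(\Delta)|_{\hat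 w=\mu}=Q_\mu(\sigma_\lambda(\Delta))$. For a real lower-triangular matrix $\|a_{ij}\|_{0\le i,j\le n}$ put $P_i(\mu)=\sum_{j\le i}a_{ij}\mu^j$. Call the matrix admissible if no row is zero and $P_i(\lambda)\ne0$ for all $i$, and in that case put $$\hat\Pi^{\|a_{ij}\|}_\lambda(\Delta)=\sum_{i=0}^n\frac{P_i(\hat w)}{P_i(\lambda)}\,\hat\Pi^{\rm DLO}_\lambda(\Delta_{n-i}).$$ Then: (0) for every weight $\mu$, $\sigma_\mu$ is the unique $\mathrm{proj}(\mathbb R^d)$-equivariant linear map from $\mathcal D^{(n)}_\mu$ to symbols of rank $\le n$ that prolongs the principal symbol map (for every $k\le n$ and $\Delta\in\mathcal D^{(k)}_\mu$, $\sigma_\mu(\Delta)$ is the rank-$k$ principal symbol of $\Delta$ plus terms of rank $<k$), and $Q_\mu$ is its inverse; (1) for every admissible matrix, $\hat\Pi^{\|a_{ij}\|}_\lambda$ is a regular $\mathrm{proj}$-equivariant pencil lifting of $\mathcal D^{(n)}_\lambda$; (2) every regular $\mathrm{proj}$-equivariant pencil lifting of $\mathcal D^{(n)}_\lambda$ equals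 $\hat\Pi^{\|a_{ij}\|}_\lambda$ for some admissible matrix; (3) sending the classes of the rows $([a_{10}:a_{11}],\dots,[a_{n0}:\dots:a_{nn}])$ of an admissible matrix to $\hat\Pi^{\|a_{ij}\|}_\lambda$ is a well-defined bijection from the set of points of $\mathbb{RP}^1\times\dots\times\mathbb{RP}^n$ with $P_i(\lambda)\neq0$ for $i=1,\dots,n$ onto the set of all regular $\mathrm{proj}$-equivariant pencil liftings of $\mathcal D^{(n)}_\lambda$. -/

import Mathlib

open scoped ContDiff
open scoped LinearAlgebra.Projectivization

namespace ProjPencil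

noncomputable section

/-! ### Smooth functions and differential operators on `ℝ^d`

In Cartesian coordinates a density of weight `μ` on `ℝ^d` is `s(x)|Dx|^μ`; it is identified with its
coefficient `s`. The weight enters only through the Lie derivative. -/

/-- The algebra of smooth real functions on `ℝ^d`. -/
def smoothAlgebra (d : ℕ) : Subalgebra ℝ ((Fin d → ℝ) → ℝ) where
  carrier := {f | ContDiff ℝ ∞ f}
  mul_mem' {f g} hf hg := by
    have hf' : ContDiff ℝ ∞ f := hf
    have hg' : ContDiff ℝ ∞ g := hg
    exact hf'.mul hg'
  add_mem' {f g} hf hg := by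
    have hf' : ContDiff ℝ ∞ f := hf
    have hg' : ContDiff ℝ ∞ g := hg
    exact hf'.add hg'
  algebraMap_mem' r := by
    have h : ContDiff ℝ ∞ (fun _ : Fin d → ℝ => r) := contDiff_const
    exact h

/-- Smooth real functions on `ℝ^d`. -/
def Smooth (d : ℕ) : Type := smoothAlgebra d

instance (d : ℕ) : CommRing (Smooth d) := inferInstanceAs (CommRing (smoothAlgebra d))

instance (d : ℕ) : Algebra ℝ (Smooth d) := inferInstanceAs (Algebra ℝ (smoothAlgebra d))

theorem Smooth.contDiff {d : ℕ} (f : Smooth d) : ContDiff ℝ ∞ f.1 := f.2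

theorem Smooth.diffAt {d : ℕ} (f : Smooth d) (x : Fin d → ℝ) : DifferentiableAt ℝ f.1 x :=
  (f.contDiff.differentiable (by simp)) x

theorem Smooth.contDiff_fderiv {d : ℕ} (f : Smooth d) : ContDiff ℝ ∞ (fderiv ℝ f.1) :=
  f.contDiff.fderiv_right (m := ∞) (by simp)

/-- All linear operators on (coefficients of) densities of a given weight. -/
abbrev Op (d : ℕ) : Type := Module.End ℝ (Smooth d)

/-- The partial derivative `∂_i`. -/
def pd {d : ℕ} (i : Fin d) : Op d where
  toFun f := ⟨fun x => fderiv ℝ f.1 x (Pi.single i 1),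
    f.contDiff_fderiv.clm_apply contDiff_const⟩
  map_add' f g := by
    refine Subtype.ext (funext fun x => ?_)
    have hf : DifferentiableAt ℝ f.1 x := f.diffAt x
    have hg : DifferentiableAt ℝ g.1 x := g.diffAt x
    change fderiv ℝ (f.1 + g.1) x _ = fderiv ℝ f.1 x _ + fderiv ℝ g.1 x _
    rw [fderiv_add hf hg]; rfl
  map_smul' c f := by
    refine Subtype.ext (funext fun x => ?_)
    have hf : DifferentiableAt ℝ f.1 x := f.diffAt x
    change fderiv ℝ (c • f.1) x _ = c • fderiv ℝ f.1 x _
    rw [fderiv_const_smul hf]; rfl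

/-- The operator of multiplication by a smooth function. -/
def mulOp {d : ℕ} (f : Smooth d) : Op d := LinearMap.mulLeft ℝ f

/-- The coordinate function `x^i`. -/
def coord {d : ℕ} (i : Fin d) : Smooth d := ⟨fun x => x i, (contDiff_apply ℝ ℝ i : ContDiff ℝ ∞ fun x : Fin d → ℝ => x i)⟩

/-- `∂_{i_1} ⋯ ∂_{i_k}` for a list of indices. -/
def pdWord {d : ℕ} (w : List (Fin d)) : Op d := (w.map pd).prod

/-- Differential operators of order `≤ n` (of weight zero) on densities of a given weight on `ℝ^d`:
finite sums of `a(x) ∂_{i_1} ⋯ ∂_{i_k}` with `k ≤ n` and smooth `a`. -/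
def diffOp (d n : ℕ) : Submodule ℝ (Op d) :=
  Submodule.span ℝ {L | ∃ (a : Smooth d) (w : List (Fin d)), w.length ≤ n ∧ L = mulOp a * pdWord w}

/-- Operator pencils: families `{Δ_μ}` with `Δ_μ` acting on densities of weight `μ`. An operator of
weight zero on the algebra of densities is identified with its pencil of restrictions to `ŵ = μ`;
the weight operator `ŵ` is the pencil `μ ↦ μ`. -/
abbrev Pencil (d : ℕ) : Type := ℝ → Op d

/-- Differential operators of order `≤ n` (of weight zero) on the algebra of densities, that is, on
the extended manifold with coordinates `(x, t)` and `ŵ = t ∂_t`: finite sums of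
`a(x) ŵ^j ∂_{i_1} ⋯ ∂_{i_k}` with `j + k ≤ n`. -/
def pencilOp (d n : ℕ) : Submodule ℝ (Pencil d) :=
  Submodule.span ℝ {D | ∃ j k : ℕ, j + k ≤ n ∧ ∃ L ∈ diffOp d k, D = fun mu => mu ^ j • L}

/-! ### Vector fields, Lie derivatives and the projective algebra -/

/-- Vector fields `X = X^i ∂_i` on `ℝ^d`, given by their components. -/
abbrev VField (d : ℕ) : Type := Fin d → Smooth d

/-- The Lie derivative `X^i ∂_i + μ (∂_i X^i)` on densities of weight `μ`. -/
def lieDer {d : ℕ} (mu : ℝ) (X : VField d) : Op d :=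
  ∑ i, (mulOp (X i) * pd i + mu • mulOp (pd i (X i)))

/-- `ad_X Δ = L_X ∘ Δ - Δ ∘ L_X` for an operator `Δ` on densities of weight `μ`. -/
def adOp {d : ℕ} (mu : ℝ) (X : VField d) (L : Op d) : Op d :=
  lieDer mu X * L - L * lieDer mu X

/-- `ad_X` on pencils. -/
def adPencil {d : ℕ} (X : VField d) (D : Pencil d) : Pencil d :=
  fun mu => adOp mu X (D mu)

/-- The Lie algebra `proj(ℝ^d)`, spanned by the translations `∂_i`, the linear fields `x^k ∂_i` and
the special projective fields `x^k ∑_i x^i ∂_i`. -/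
def projFields (d : ℕ) : Submodule ℝ (VField d) :=
  Submodule.span ℝ
    ({X | ∃ i : Fin d, X = Pi.single i 1} ∪ {X | ∃ k i : Fin d, X = Pi.single i (coord k)} ∪
      {X | ∃ k : Fin d, X = fun i => coord k * coord i})

/-! ### `ad_X` preserves the order of differential operators -/

theorem pd_comm {d : ℕ} (i j : Fin d) : pd i * pd j = pd j * pd i := by
  refine LinearMap.ext fun f => Subtype.ext (funext fun x => ?_)
  have h2 : ContDiff ℝ ∞ (fderiv ℝ f.1) := f.contDiff_fderiv
  have hd : DifferentiableAt ℝ (fderiv ℝ f.1) x := (h2.differentiable (by simp)) x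
  have hs : IsSymmSndFDerivAt ℝ f.1 x :=
    ContDiffAt.isSymmSndFDerivAt (n := ∞) f.contDiff.contDiffAt (by simpa using (by exact_mod_cast le_top : ((2 : ℕ∞) : WithTop ℕ∞) ≤ ((⊤ : ℕ∞) : WithTop ℕ∞)))
  change fderiv ℝ (fun y => fderiv ℝ f.1 y (Pi.single j 1)) x (Pi.single i 1)
    = fderiv ℝ (fun y => fderiv ℝ f.1 y (Pi.single i 1)) x (Pi.single j 1)
  rw [fderiv_clm_apply hd (differentiableAt_const _), fderiv_clm_apply hd (differentiableAt_const _)]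
  simpa using hs.eq _ _

theorem pd_mulOp {d : ℕ} (i : Fin d) (f : Smooth d) :
    pd i * mulOp f = mulOp f * pd i + mulOp (pd i f) := by
  refine LinearMap.ext fun g => Subtype.ext (funext fun x => ?_)
  have hf : DifferentiableAt ℝ f.1 x := f.diffAt x
  have hg : DifferentiableAt ℝ g.1 x := g.diffAt x
  change fderiv ℝ (f.1 * g.1) x (Pi.single i 1)
    = f.1 x * fderiv ℝ g.1 x (Pi.single i 1) + fderiv ℝ f.1 x (Pi.single i 1) * g.1 x
  rw [fderiv_mul hf hg]
  simp [mul_comm]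

theorem mulOp_mul {d : ℕ} (f g : Smooth d) : mulOp f * mulOp g = mulOp (f * g) :=
  LinearMap.ext fun h => (mul_assoc f g h).symm

theorem mulOp_mem {d n : ℕ} (f : Smooth d) {L : Op d} (hL : L ∈ diffOp d n) :
    mulOp f * L ∈ diffOp d n := by
  induction hL using Submodule.span_induction with
  | mem x hx =>
    obtain ⟨a, w, hw, rfl⟩ := hx
    exact Submodule.subset_span ⟨f * a, w, hw, by rw [← mul_assoc, mulOp_mul]⟩
  | zero => simp
  | add x y _ _ hx hy => rw [mul_add]; exact add_mem hx hy
  | smul c x _ hx => rw [mul_smul_comm]; exact Submodule.smul_mem _ _ hx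

theorem diffOp_mono {d m n : ℕ} (h : m ≤ n) : diffOp d m ≤ diffOp d n :=
  Submodule.span_mono fun _ ⟨a, w, hw, e⟩ => ⟨a, w, hw.trans h, e⟩

theorem pd_mem {d n : ℕ} (i : Fin d) {L : Op d} (hL : L ∈ diffOp d n) :
    pd i * L ∈ diffOp d (n + 1) := by
  induction hL using Submodule.span_induction with
  | mem x hx =>
    obtain ⟨a, w, hw, rfl⟩ := hx
    rw [← mul_assoc, pd_mulOp, add_mul]
    refine add_mem (Submodule.subset_span ⟨a, i :: w, by simpa using hw, ?_⟩)
      (Submodule.subset_span ⟨pd i a, w, by omega, rfl⟩)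
    rw [mul_assoc]; simp [pdWord]
  | zero => simp
  | add x y _ _ hx hy => rw [mul_add]; exact add_mem hx hy
  | smul c x _ hx => rw [mul_smul_comm]; exact Submodule.smul_mem _ _ hx

theorem mem_pd {d n : ℕ} (i : Fin d) {L : Op d} (hL : L ∈ diffOp d n) :
    L * pd i ∈ diffOp d (n + 1) := by
  induction hL using Submodule.span_induction with
  | mem x hx =>
    obtain ⟨a, w, hw, rfl⟩ := hx
    refine Submodule.subset_span ⟨a, w ++ [i], by simpa using hw, ?_⟩
    rw [mul_assoc]; simp [pdWord]
  | zero => simp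
  | add x y _ _ hx hy => rw [add_mul]; exact add_mem hx hy
  | smul c x _ hx => rw [smul_mul_assoc]; exact Submodule.smul_mem _ _ hx

theorem pdWord_mem {d : ℕ} (w : List (Fin d)) : pdWord w ∈ diffOp d w.length :=
  Submodule.subset_span ⟨1, w, le_rfl, by
    have : mulOp (1 : Smooth d) = 1 := LinearMap.mulLeft_one ℝ (Smooth d)
    rw [this, one_mul]⟩

theorem pdWord_comm_mem {d : ℕ} (f : Smooth d) (w : List (Fin d)) :
    ∀ n, w.length ≤ n + 1 → pdWord w * mulOp f - mulOp f * pdWord w ∈ diffOp d n := by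
  induction w with
  | nil => intro n _; simp [pdWord]
  | cons i w ih =>
    intro n hn
    have e : pdWord (i :: w) * mulOp f - mulOp f * pdWord (i :: w)
        = pd i * (pdWord w * mulOp f - mulOp f * pdWord w) + mulOp (pd i f) * pdWord w := by
      have h1 : pdWord (i :: w) = pd i * pdWord w := by simp [pdWord]
      have h2 : mulOp (pd i f) = pd i * mulOp f - mulOp f * pd i := by rw [pd_mulOp]; abel
      rw [h1, h2]
      simp only [mul_sub, sub_mul, mul_assoc]; abel
    rw [e]
    have hn' : w.length ≤ n := by simpa using hn
    refine add_mem ?_ (mulOp_mem _ (diffOp_mono hn' (pdWord_mem w)))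
    cases n with
    | zero =>
      have : w = [] := List.length_eq_zero_iff.mp (by omega)
      subst this; simp [pdWord]
    | succ m => exact pd_mem i (ih m hn')

theorem pd_pdWord {d : ℕ} (i : Fin d) (w : List (Fin d)) : pd i * pdWord w = pdWord w * pd i := by
  induction w with
  | nil => simp [pdWord]
  | cons j w ih =>
    have h1 : pdWord (j :: w) = pd j * pdWord w := by simp [pdWord]
    rw [h1, ← mul_assoc, pd_comm, mul_assoc, ih, mul_assoc]

theorem adOp_mem {d n : ℕ} (mu : ℝ) (X : VField d) {L : Op d} (hL : L ∈ diffOp d n) :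
    adOp mu X L ∈ diffOp d n := by
  have key : ∀ (g : Smooth d), mulOp g * L - L * mulOp g ∈ diffOp d n := by
    intro g
    induction hL using Submodule.span_induction with
    | mem x hx =>
      obtain ⟨a, w, hw, rfl⟩ := hx
      have e : mulOp g * (mulOp a * pdWord w) - mulOp a * pdWord w * mulOp g
          = - (mulOp a * (pdWord w * mulOp g - mulOp g * pdWord w)) := by
        rw [← mul_assoc, mulOp_mul, mul_comm g a, ← mulOp_mul]
        simp only [mul_sub, mul_assoc]; abel
      rw [e]
      exact neg_mem (mulOp_mem _ (pdWord_comm_mem g w n (by omega)))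
    | zero => simp
    | add x y _ _ hx hy =>
      rw [show mulOp g * (x + y) - (x + y) * mulOp g
        = (mulOp g * x - x * mulOp g) + (mulOp g * y - y * mulOp g) by noncomm_ring]
      exact add_mem hx hy
    | smul c x _ hx =>
      rw [mul_smul_comm, smul_mul_assoc, ← smul_sub]; exact Submodule.smul_mem _ _ hx
  have key2 : ∀ (f : Smooth d) (i : Fin d),
      mulOp f * pd i * L - L * (mulOp f * pd i) ∈ diffOp d n := by
    intro f i
    clear key
    induction hL using Submodule.span_induction with
    | mem x hx =>
      obtain ⟨a, w, hw, rfl⟩ := hx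
      have e : mulOp f * pd i * (mulOp a * pdWord w) - mulOp a * pdWord w * (mulOp f * pd i)
          = mulOp (f * pd i a) * pdWord w
            - mulOp a * ((pdWord w * mulOp f - mulOp f * pdWord w) * pd i) := by
        have h1 : mulOp f * pd i * (mulOp a * pdWord w)
            = mulOp (f * pd i a) * pdWord w + mulOp (a * f) * (pdWord w * pd i) := by
          rw [mul_assoc, ← mul_assoc (pd i), pd_mulOp, add_mul, mul_add, mul_assoc (mulOp a),
            pd_pdWord, ← mul_assoc, ← mul_assoc (mulOp f), mulOp_mul, mulOp_mul, mul_comm f a,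
            add_comm]
        rw [h1, ← mulOp_mul a f]
        simp only [mul_sub, sub_mul, mul_assoc]; abel
      rw [e]
      refine sub_mem (mulOp_mem _ (diffOp_mono hw (pdWord_mem w))) (mulOp_mem _ ?_)
      cases n with
      | zero =>
        have : w = [] := List.length_eq_zero_iff.mp (by omega)
        subst this; simp [pdWord]
      | succ m => exact mem_pd i (pdWord_comm_mem f w m hw)
    | zero => simp
    | add x y _ _ hx hy =>
      rw [show mulOp f * pd i * (x + y) - (x + y) * (mulOp f * pd i)
        = (mulOp f * pd i * x - x * (mulOp f * pd i))
          + (mulOp f * pd i * y - y * (mulOp f * pd i)) by noncomm_ring]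
      exact add_mem hx hy
    | smul c x _ hx =>
      rw [mul_smul_comm, smul_mul_assoc, ← smul_sub]; exact Submodule.smul_mem _ _ hx
  unfold adOp lieDer
  rw [Finset.sum_mul, Finset.mul_sum, ← Finset.sum_sub_distrib]
  refine sum_mem fun i _ => ?_
  rw [add_mul, mul_add, smul_mul_assoc, mul_smul_comm, add_sub_add_comm]
  have h := Submodule.smul_mem _ mu (key (pd i (X i)))
  rw [smul_sub] at h
  exact add_mem (key2 _ _) h

/-- `ad_X` as a map on the space of operators of order `≤ n` on densities of weight `μ`. -/
def adDiff {d n : ℕ} (mu : ℝ) (X : VField d) (L : diffOp d n) : diffOp d n :=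
  ⟨adOp mu X L.1, adOp_mem mu X L.2⟩

/-! ### Pencil liftings -/

/-- Linear maps from operators of order `≤ n` on densities of a fixed weight to pencils. -/
abbrev LiftMap (d n : ℕ) : Type := diffOp d n →ₗ[ℝ] Pencil d

/-- `F` is a regular `proj(ℝ^d)`-equivariant pencil lifting of the operators of order `≤ n` on
densities of weight `lam`. -/
structure IsRegularProjLifting (d n : ℕ) (lam : ℝ) (F : LiftMap d n) : Prop where
  passes : ∀ L : diffOp d n, F L lam = L
  regular : ∀ L : diffOp d n, F L ∈ pencilOp d n
  equivariant : ∀ X ∈ projFields d, ∀ L : diffOp d n, F (adDiff lam X L) = adPencil X (F L)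

/-! ### Symbols -/

/-- Symbols: functions on `T^*ℝ^d` polynomial in the momenta `ξ_i`, with smooth coefficients. The
symmetric contravariant tensor field `S^{i_1 … i_k}` is `S^{i_1 … i_k} ξ_{i_1} ⋯ ξ_{i_k}`. -/
abbrev Sym (d : ℕ) : Type := MvPolynomial (Fin d) (Smooth d)

/-- The `ℝ`-linear map on symbols that sends `a ξ^α` to `φ α a`. -/
def symLift {d : ℕ} {V : Type} [AddCommGroup V] [Module ℝ V]
    (φ : (Fin d →₀ ℕ) → Smooth d →ₗ[ℝ] V) : Sym d →ₗ[ℝ] V :=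
  Finsupp.lsum ℝ φ ∘ₗ
    ((MvPolynomial.basisMonomials (Fin d) (Smooth d)).repr.toLinearMap.restrictScalars ℝ)

theorem symLift_monomial {d : ℕ} {V : Type} [AddCommGroup V] [Module ℝ V]
    (φ : (Fin d →₀ ℕ) → Smooth d →ₗ[ℝ] V) (α : Fin d →₀ ℕ) (a : Smooth d) :
    symLift φ (MvPolynomial.monomial α a) = φ α a := by
  have h : (MvPolynomial.basisMonomials (Fin d) (Smooth d)).repr (MvPolynomial.monomial α a)
      = Finsupp.single α a := rfl
  simp [symLift, h]

/-- The derivative `∂/∂x^i` of the coefficients of a symbol. -/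
def coeffPd {d : ℕ} (i : Fin d) : Sym d →ₗ[ℝ] Sym d :=
  symLift fun α => (MvPolynomial.monomial α).restrictScalars ℝ ∘ₗ pd i

/-- The derivative `∂/∂ξ_i` of a symbol. -/
def xiPd {d : ℕ} (i : Fin d) : Sym d →ₗ[ℝ] Sym d :=
  (MvPolynomial.pderiv i).toLinearMap.restrictScalars ℝ

/-- The divergence `∑_j ∂²/∂x^j∂ξ_j`; on tensors of rank `k` it is
`S^{i_1 … i_k} ↦ k ∂_j S^{j i_2 … i_k}`. -/
def divSym {d : ℕ} : Module.End ℝ (Sym d) := ∑ j, coeffPd j ∘ₗ xiPd j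

/-- The Lie derivative of symbols (symmetric contravariant tensor fields),
`L_X S = X^i ∂S/∂x^i - (∂_j X^i) ξ_i ∂S/∂ξ_j`. -/
def lieSym {d : ℕ} (X : VField d) (S : Sym d) : Sym d :=
  ∑ i, X i • coeffPd i S - ∑ i, ∑ j, pd j (X i) • (MvPolynomial.X i * xiPd j S)

/-- Normal ordering `a ξ^α ↦ a ∂^α`. -/
def normalOrder {d : ℕ} : Sym d →ₗ[ℝ] Op d :=
  symLift fun α => LinearMap.mulRight ℝ ((List.ofFn fun i => (pd i : Op d) ^ α i).prod) ∘ₗ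
    (Algebra.lmul ℝ (Smooth d)).toLinearMap

/-- The principal symbol of rank `k`, for operators of order `≤ k`:
`S^{i_1 … i_k} ∂_{i_1} ⋯ ∂_{i_k} + … ↦ S^{i_1 … i_k} ξ_{i_1} ⋯ ξ_{i_k}`. It is computed from
`S^{i_1 … i_k} = [… [Δ, x^{i_1}], …, x^{i_k}](1) / k!`, by recursion on `k`. -/
def prinSymbol {d : ℕ} : ℕ → Op d →ₗ[ℝ] Sym d
  | 0 => (MvPolynomial.monomial 0).restrictScalars ℝ ∘ₗ LinearMap.applyₗ (1 : Smooth d)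
  | k + 1 => ((k + 1 : ℝ)⁻¹) • ∑ i : Fin d,
      LinearMap.mulLeft ℝ (MvPolynomial.X i : Sym d) ∘ₗ prinSymbol k ∘ₗ
        (LinearMap.mulRight ℝ (mulOp (coord i)) - LinearMap.mulLeft ℝ (mulOp (coord i)))

/-! ### Projectively equivariant quantisation and the DLO lifting -/

/-- The coefficient `(1/r!) ∏_{j=1}^{r} ((d+1)μ + k - j)/(d + 2k - j)`. -/
def quantCoeff (d k r : ℕ) (mu : ℝ) : ℝ :=
  (1 / (r.factorial : ℝ)) *
    ∏ j ∈ Finset.Icc 1 r, (((d + 1 : ℝ) * mu + k - j) / ((d : ℝ) + 2 * k - j))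

/-- The projective quantisation `Q_μ` on symbols of rank `k` (zero on the other ranks). -/
def quantRank {d : ℕ} (k : ℕ) (mu : ℝ) : Sym d →ₗ[ℝ] Op d :=
  (∑ r ∈ Finset.range (k + 1), quantCoeff d k r mu • (normalOrder ∘ₗ divSym ^ r)) ∘ₗ
    (MvPolynomial.homogeneousComponent k).restrictScalars ℝ

/-- The projective quantisation `Q_μ` on symbols of rank `≤ n`. -/
def quant {d : ℕ} (n : ℕ) (mu : ℝ) : Sym d →ₗ[ℝ] Op d :=
  ∑ k ∈ Finset.range (n + 1), quantRank k mu

/-- `Δ - Δ_n - … - Δ_{n-i+1}`, where `Δ = Δ_n + … + Δ_0` is the canonical decomposition of an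
operator of order `≤ n` on densities of weight `lam`: each `Δ_k` is `Q_lam` of the principal symbol
of rank `k` of the remainder `Δ - Δ_n - … - Δ_{k+1}`. -/
def remainder {d : ℕ} (n : ℕ) (lam : ℝ) : ℕ → (Op d →ₗ[ℝ] Op d)
  | 0 => LinearMap.id
  | i + 1 => remainder n lam i -
      quantRank (n - i) lam ∘ₗ prinSymbol (n - i) ∘ₗ remainder n lam i

/-- The component `Δ_{n-i}` of the canonical decomposition, for `i ≤ n`. -/
def component {d : ℕ} (n : ℕ) (lam : ℝ) (i : ℕ) : Op d →ₗ[ℝ] Op d :=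
  quantRank (n - i) lam ∘ₗ prinSymbol (n - i) ∘ₗ remainder n lam i

/-- The full symbol map `σ_lam` on operators of order `≤ n` on densities of weight `lam`: the sum of
the principal symbols of the components `Δ_n, …, Δ_0`. -/
def fullSymbol {d : ℕ} (n : ℕ) (lam : ℝ) : Op d →ₗ[ℝ] Sym d :=
  ∑ i ∈ Finset.range (n + 1), prinSymbol (n - i) ∘ₗ remainder n lam i

/-- The Duval-Lecomte-Ovsienko pencil lifting: `Π^{DLO}(Δ)` at `ŵ = μ` is `Q_μ(σ_lam(Δ))`. -/
def dlo {d : ℕ} (n : ℕ) (lam mu : ℝ) : Op d →ₗ[ℝ] Op d := quant n mu ∘ₗ fullSymbol n lam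

/-- `σ` is a `proj(ℝ^d)`-equivariant full symbol map on operators of order `≤ n` on densities of
weight `mu`: it is equivariant and prolongs the principal symbol map. -/
structure IsProjFullSymbol (d n : ℕ) (mu : ℝ) (σ : diffOp d n →ₗ[ℝ] Sym d) : Prop where
  degree_le : ∀ L, (σ L).totalDegree ≤ n
  principal : ∀ k ≤ n, ∀ L : diffOp d n, L.1 ∈ diffOp d k →
    ∀ m, k ≤ m → MvPolynomial.homogeneousComponent m (σ L - prinSymbol k L.1) = 0
  equivariant : ∀ X ∈ projFields d, ∀ L : diffOp d n, σ (adDiff mu X L) = lieSym X (σ L)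

/-! ### Dressing by triangular matrices -/

/-- The polynomial `P_i(μ) = ∑_j a_{ij} μ^j` of the `i`-th row. -/
def rowPoly {n : ℕ} (a : Matrix (Fin (n + 1)) (Fin (n + 1)) ℝ) (i : Fin (n + 1)) (mu : ℝ) : ℝ :=
  ∑ j, a i j * mu ^ (j : ℕ)

/-- Lower-triangular matrices without zero rows such that the ratios `P_i(μ)/P_i(lam)` make sense. -/
structure IsAdmissible {n : ℕ} (lam : ℝ) (a : Matrix (Fin (n + 1)) (Fin (n + 1)) ℝ) : Prop where
  lower : ∀ i j, i < j → a i j = 0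
  row_ne : ∀ i, ∃ j, a i j ≠ 0
  denom_ne : ∀ i, rowPoly a i lam ≠ 0

/-- The dressed lifting `Δ ↦ ∑_{i=0}^n (P_i(ŵ)/P_i(lam)) Π^{DLO}(Δ_{n-i})`. -/
def dressed (d : ℕ) {n : ℕ} (lam : ℝ) (a : Matrix (Fin (n + 1)) (Fin (n + 1)) ℝ) : LiftMap d n :=
  LinearMap.pi fun mu =>
    (∑ i : Fin (n + 1), (rowPoly a i mu / rowPoly a i lam) •
      (dlo n lam mu ∘ₗ component n lam i)) ∘ₗ (diffOp d n).subtype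

/-- The points of `ℝP^1 × ⋯ × ℝP^n` at which no denominator `P_i(lam)` vanishes: the factor with
index `i` is `ℝP^{i+1}`, with homogeneous coordinates `[p_0 : … : p_{i+1}]`, and the condition on it
is `p_0 + p_1 lam + … + p_{i+1} lam^{i+1} ≠ 0`. -/
def Param (n : ℕ) (lam : ℝ) : Type :=
  {p : (i : Fin n) → ℙ ℝ (Fin ((i : ℕ) + 2) → ℝ) //
    ∀ i, ∑ j, (p i).rep j * lam ^ (j : ℕ) ≠ 0}

/-- The `i`-th row below the top one, without the zeros above the diagonal. -/
def rowVec {n : ℕ} (a : Matrix (Fin (n + 1)) (Fin (n + 1)) ℝ) (i : Fin n) :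
    Fin ((i : ℕ) + 2) → ℝ :=
  fun j => a i.succ (Fin.castLE (by omega) j)

theorem rowPoly_succ {n : ℕ} {lam : ℝ} {a : Matrix (Fin (n + 1)) (Fin (n + 1)) ℝ}
    (h : IsAdmissible lam a) (i : Fin n) (mu : ℝ) :
    rowPoly a i.succ mu = ∑ j, rowVec a i j * mu ^ (j : ℕ) := by
  have hle : (i : ℕ) + 2 ≤ n + 1 := by omega
  have hinj : Function.Injective (Fin.castLE hle) := Fin.castLE_injective hle
  unfold rowPoly rowVec
  refine (Finset.sum_of_injOn (Fin.castLE hle) hinj.injOn (fun _ _ => Finset.mem_coe.2 (Finset.mem_univ _)) ?_ ?_).symm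
  · intro j _ hj
    rw [h.lower i.succ j, zero_mul]
    by_contra hc
    have hc' : (j : ℕ) ≤ (i : ℕ) + 1 := by
      have := not_lt.1 hc
      simpa [Fin.le_def] using this
    exact hj ⟨⟨j, by omega⟩, Finset.mem_coe.2 (Finset.mem_univ _), Fin.ext rfl⟩
  · intro j _; rfl

theorem rowVec_ne {n : ℕ} {lam : ℝ} {a : Matrix (Fin (n + 1)) (Fin (n + 1)) ℝ}
    (h : IsAdmissible lam a) (i : Fin n) : rowVec a i ≠ 0 := by
  intro h0
  apply h.denom_ne i.succ
  rw [rowPoly_succ h, h0]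
  simp

/-- The point of `ℝP^1 × ⋯ × ℝP^n` given by the rows `1, …, n` of a matrix. -/
def toParam {n : ℕ} {lam : ℝ} (a : Matrix (Fin (n + 1)) (Fin (n + 1)) ℝ)
    (h : IsAdmissible lam a) : Param n lam :=
  ⟨fun i => Projectivization.mk ℝ (rowVec a i) (rowVec_ne h i), by
    intro i h0
    obtain ⟨c, hc⟩ := Projectivization.exists_smul_eq_mk_rep ℝ (rowVec a i) (rowVec_ne h i)
    rw [← hc] at h0
    apply h.denom_ne i.succ
    rw [rowPoly_succ h]
    have : (c : ℝ) * ∑ j, rowVec a i j * lam ^ (j : ℕ) = 0 := by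
      rw [← h0, Finset.mul_sum]
      refine Finset.sum_congr rfl fun j _ => ?_
      simp [Units.smul_def, mul_assoc]
    exact (mul_eq_zero.1 this).resolve_left c.ne_zero⟩

end

end ProjPencil

namespace ProjPencil

noncomputable section

open MvPolynomial (X C monomial pderiv homogeneousComponent)

/-! ### Smooth functions -/

/-! Normal ordering identifies symbols of rank `≤ n` with operators of order `≤ n`. It intertwines
the actions of affine vector fields, but a special field `y^k y^i ∂_i` leaves the defect `-(E +
(d+1)μ) ∂/∂ξ_k`, with `E` the Euler operator in the momenta (`adOp_special_normalOrder`). The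
divergence commutes with affine fields, and its commutator with the special field is `-(2E + d + 1)
∂/∂ξ_k` (`divSym_lieSpecial`). A series in powers of the divergence can therefore compensate the
defect, through a two-term recursion on its coefficients which `quantCoeff` solves
(`quantCoeff_succ`). Hence `Q_μ` is equivariant. As `Q_μ(S)` is the normally ordered `S` plus terms
of lower rank, peeling off principal symbols inverts it.

Rigidity is a Schur lemma (`IsProjEquivariant.exists_scalar`): a linear equivariant endomorphism `T`
of the symbols, with no locality or continuity assumed, is a scalar on each rank. The Euler and
special fields centred at `x₀` force `T(y^j S)` to vanish at `x₀`. By Hadamard's lemma `T` is then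
linear over smooth functions; translations make its coefficients constant, and the action of linear
fields leaves one scalar per rank.

Applied to `σ ∘ Q_μ`, this gives uniqueness of the full symbol map. Applied at each weight `μ` to a
lifting `F`, it gives `F(Q_λ S)|_μ = c_k(μ) Q_μ(S)` for `S` of rank `k`. Taking principal symbols,
regularity makes `c_k` a polynomial of degree at most `n - k`, and passing through `Δ` means `c_k(λ)
= 1`. Conversely all such polynomials occur, because the part of `Q_μ(S)` of order at most `k - r`
has degree at most `r` in `μ`. Rows of a matrix encode these polynomials up to scale, whence the
projective spaces. -/

theorem Smooth.ext {d : ℕ} {f g : Smooth d} (h : ∀ x, f.1 x = g.1 x) : f = g :=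
  Subtype.ext (funext h)

/-- Evaluation at a point. -/
def evalAt {d : ℕ} (x : Fin d → ℝ) : Smooth d →ₐ[ℝ] ℝ :=
  (Pi.evalAlgHom ℝ (fun _ : Fin d → ℝ => ℝ) x).comp (smoothAlgebra d).val

theorem evalAt_apply {d : ℕ} (x : Fin d → ℝ) (f : Smooth d) : evalAt x f = f.1 x := rfl

theorem mulOp_apply {d : ℕ} (f g : Smooth d) : mulOp f g = f * g := rfl

theorem mulOp_one {d : ℕ} : mulOp (1 : Smooth d) = 1 := LinearMap.mulLeft_one ℝ (Smooth d)

theorem pd_mul {d : ℕ} (i : Fin d) (f g : Smooth d) : pd i (f * g) = f * pd i g + pd i f * g :=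
  LinearMap.congr_fun (pd_mulOp i f) g

theorem pd_algebraMap {d : ℕ} (i : Fin d) (r : ℝ) : pd i (algebraMap ℝ (Smooth d) r) = 0 := by
  refine Smooth.ext fun x => ?_
  change fderiv ℝ (fun _ : Fin d → ℝ => r) x _ = 0
  simp

theorem pd_one {d : ℕ} (i : Fin d) : pd i (1 : Smooth d) = 0 := by
  simpa using pd_algebraMap i 1

theorem pd_coord {d : ℕ} (j i : Fin d) : pd j (coord i) = if j = i then 1 else 0 := by
  refine Smooth.ext fun x => ?_
  have h : fderiv ℝ (fun x : Fin d → ℝ => x i) x = ContinuousLinearMap.proj i :=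
    (ContinuousLinearMap.proj (R := ℝ) (φ := fun _ : Fin d => ℝ) i).fderiv
  change fderiv ℝ (fun x : Fin d → ℝ => x i) x (Pi.single j 1) = _
  rw [h]
  by_cases hij : j = i
  · subst hij
    simp only [ContinuousLinearMap.proj_apply, Pi.single_eq_same, if_true]; rfl
  · simp only [ContinuousLinearMap.proj_apply, if_neg hij, Pi.single_eq_of_ne' hij]; rfl

/-- A system of affine coordinates obtained from the standard one by a translation. -/
def coordAt {d : ℕ} (x₀ : Fin d → ℝ) (i : Fin d) : Smooth d :=
  coord i - algebraMap ℝ (Smooth d) (x₀ i)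

theorem pd_coordAt {d : ℕ} (x₀ : Fin d → ℝ) (j i : Fin d) :
    pd j (coordAt x₀ i) = if j = i then 1 else 0 := by
  rw [coordAt, map_sub, pd_coord, pd_algebraMap, sub_zero]

theorem evalAt_coordAt {d : ℕ} (x₀ : Fin d → ℝ) (i : Fin d) : evalAt x₀ (coordAt x₀ i) = 0 := by
  rw [coordAt, map_sub, AlgHom.commutes]
  exact sub_self (x₀ i)

/-! ### The operators on symbols -/

/-- The maps are only `ℝ`-linear, so every coefficient function has to be tested, not just the
monomials `ξ^α`. -/
theorem sym_hom_ext {d : ℕ} {V : Type*} [AddCommGroup V] [Module ℝ V] {f g : Sym d →ₗ[ℝ] V}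
    (h : ∀ α a, f (monomial α a) = g (monomial α a)) : f = g := by
  refine LinearMap.ext fun p => ?_
  induction p using MvPolynomial.induction_on' with
  | monomial u a => exact h u a
  | add p q hp hq => rw [map_add, map_add, hp, hq]

theorem coeffPd_monomial {d : ℕ} (i : Fin d) (α : Fin d →₀ ℕ) (a : Smooth d) :
    coeffPd i (monomial α a) = monomial α (pd i a) := by
  rw [coeffPd, symLift_monomial]; rfl

theorem coeff_coeffPd {d : ℕ} (i : Fin d) (S : Sym d) (α : Fin d →₀ ℕ) :
    (coeffPd i S).coeff α = pd i (S.coeff α) := by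
  induction S using MvPolynomial.induction_on' with
  | monomial u a =>
    rw [coeffPd_monomial, MvPolynomial.coeff_monomial, MvPolynomial.coeff_monomial]
    split_ifs <;> simp
  | add p q hp hq => simp [hp, hq]

theorem xiPd_apply {d : ℕ} (i : Fin d) (S : Sym d) : xiPd i S = pderiv i S := rfl

/-- Multiplication by a function on symbols. -/
def mulSym {d : ℕ} (f : Smooth d) : Module.End ℝ (Sym d) := LinearMap.mulLeft ℝ (C f)

/-- Multiplication by the momentum `ξ_i` on symbols. -/
def xiMul {d : ℕ} (i : Fin d) : Module.End ℝ (Sym d) := LinearMap.mulLeft ℝ (X i)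

theorem mulSym_apply {d : ℕ} (f : Smooth d) (S : Sym d) : mulSym f S = C f * S := rfl

theorem xiMul_apply {d : ℕ} (i : Fin d) (S : Sym d) : xiMul i S = X i * S := rfl

theorem smul_sym {d : ℕ} (f : Smooth d) (S : Sym d) : f • S = mulSym f S :=
  MvPolynomial.smul_eq_C_mul S f

theorem mulSym_zero {d : ℕ} : mulSym (0 : Smooth d) = 0 :=
  LinearMap.ext fun S => by simp [mulSym_apply]

theorem mulSym_one {d : ℕ} : mulSym (1 : Smooth d) = 1 :=
  LinearMap.ext fun S => by simp [mulSym_apply]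

theorem mulSym_add {d : ℕ} (f g : Smooth d) : mulSym (f + g) = mulSym f + mulSym g :=
  LinearMap.ext fun S => by simp [mulSym_apply, add_mul]

theorem mulSym_mul {d : ℕ} (f g : Smooth d) : mulSym (f * g) = mulSym f * mulSym g :=
  LinearMap.ext fun S => by simp [mulSym_apply, mul_assoc]

theorem coeffPd_mulSym {d : ℕ} (i : Fin d) (f : Smooth d) :
    coeffPd i * mulSym f = mulSym f * coeffPd i + mulSym (pd i f) := by
  refine sym_hom_ext fun α a => ?_
  simp only [Module.End.mul_apply, LinearMap.add_apply, mulSym_apply, MvPolynomial.C_mul_monomial,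
    coeffPd_monomial, pd_mul, map_add]

theorem coeffPd_xiMul {d : ℕ} (i j : Fin d) : coeffPd i * xiMul j = xiMul j * coeffPd i := by
  refine sym_hom_ext fun α a => ?_
  have h : ∀ b : Smooth d, xiMul j (monomial α b) = monomial (Finsupp.single j 1 + α) b := by
    intro b; rw [xiMul_apply, MvPolynomial.X, MvPolynomial.monomial_mul, one_mul]
  simp only [Module.End.mul_apply, h, coeffPd_monomial]

theorem xiPd_xiMul {d : ℕ} (i j : Fin d) :
    xiPd i * xiMul j = xiMul j * xiPd i + if i = j then 1 else 0 := by
  refine LinearMap.ext fun S => ?_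
  simp only [Module.End.mul_apply, LinearMap.add_apply, xiMul_apply, xiPd_apply,
    Derivation.leibniz, MvPolynomial.pderiv_X, smul_eq_mul]
  by_cases h : i = j
  · subst h; simp
  · simp [h]

theorem xiPd_mulSym {d : ℕ} (i : Fin d) (f : Smooth d) :
    xiPd i * mulSym f = mulSym f * xiPd i := by
  refine LinearMap.ext fun S => ?_
  simp only [Module.End.mul_apply, mulSym_apply, xiPd_apply, MvPolynomial.pderiv_C_mul]

theorem xiMul_mulSym {d : ℕ} (i : Fin d) (f : Smooth d) :
    xiMul i * mulSym f = mulSym f * xiMul i :=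
  LinearMap.ext fun S => by simp only [Module.End.mul_apply, mulSym_apply, xiMul_apply]; ring

theorem mulSym_comm {d : ℕ} (f g : Smooth d) : mulSym f * mulSym g = mulSym g * mulSym f := by
  rw [← mulSym_mul, mul_comm, mulSym_mul]

theorem xiMul_comm {d : ℕ} (i j : Fin d) : xiMul i * xiMul j = xiMul j * xiMul (d := d) i :=
  LinearMap.ext fun S => by simp only [Module.End.mul_apply, xiMul_apply]; ring

theorem coeffPd_comm {d : ℕ} (i j : Fin d) :
    (coeffPd i * coeffPd j : Module.End ℝ (Sym d)) = coeffPd j * coeffPd i := by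
  refine sym_hom_ext fun α a => ?_
  simp only [Module.End.mul_apply, coeffPd_monomial]
  rw [show pd i (pd j a) = pd j (pd i a) from LinearMap.congr_fun (pd_comm i j) a]

theorem xiPd_coeffPd {d : ℕ} (i j : Fin d) :
    (xiPd i * coeffPd j : Module.End ℝ (Sym d)) = coeffPd j * xiPd i := by
  refine sym_hom_ext fun α a => ?_
  simp only [Module.End.mul_apply, coeffPd_monomial, xiPd_apply, MvPolynomial.pderiv_monomial]
  congr 1
  rw [mul_comm, mul_comm a, ← nsmul_eq_mul, ← nsmul_eq_mul, map_nsmul]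

theorem xiPd_comm {d : ℕ} (i j : Fin d) :
    (xiPd i * xiPd j : Module.End ℝ (Sym d)) = xiPd j * xiPd i := by
  refine LinearMap.ext fun S => ?_
  have h : ⁅(pderiv i : Derivation (Smooth d) (Sym d) (Sym d)),
      (pderiv j : Derivation (Smooth d) (Sym d) (Sym d))⁆ = 0 := by
    refine MvPolynomial.derivation_ext fun k => ?_
    simp [Derivation.commutator_apply, MvPolynomial.pderiv_X, Pi.single_apply]
    split_ifs <;> simp
  have h' := DFunLike.congr_fun h S
  rw [Derivation.commutator_apply] at h'
  exact sub_eq_zero.1 h'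

/-- The Euler operator `∑ ξ_i ∂/∂ξ_i`, equal to the rank on homogeneous symbols. -/
def xiEuler (d : ℕ) : Module.End ℝ (Sym d) := ∑ i, xiMul i * xiPd i

/-! ### Commutation relations for Euler operators, divergence and coordinates -/

section Coordinates

/-- The Euler operator `∑ y^i ∂_i` on the coefficients of symbols. -/
def baseEuler {d : ℕ} (y : Fin d → Smooth d) : Module.End ℝ (Sym d) := ∑ i, mulSym (y i) * coeffPd i

/-- Multiplication by `∑ y^i ξ_i`. -/
def pairMul {d : ℕ} (y : Fin d → Smooth d) : Module.End ℝ (Sym d) := ∑ i, mulSym (y i) * xiMul i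

theorem divSym_eq {d : ℕ} : (divSym : Module.End ℝ (Sym d)) = ∑ j, coeffPd j * xiPd j := rfl

theorem xiPd_xiEuler {d : ℕ} (j : Fin d) : xiPd j * xiEuler d = xiEuler d * xiPd j + xiPd j := by
  simp only [xiEuler, Finset.mul_sum, Finset.sum_mul, ← mul_assoc, xiPd_xiMul, add_mul,
    Finset.sum_add_distrib, ite_mul, one_mul, zero_mul, Finset.sum_ite_eq, Finset.mem_univ, if_true]
  simp only [mul_assoc, xiPd_comm j]

theorem coeffPd_xiEuler {d : ℕ} (j : Fin d) : coeffPd j * xiEuler d = xiEuler d * coeffPd j := by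
  simp only [xiEuler, Finset.mul_sum, Finset.sum_mul, ← mul_assoc, coeffPd_xiMul]
  simp only [mul_assoc, xiPd_coeffPd]

theorem divSym_xiEuler {d : ℕ} : divSym * xiEuler d = xiEuler d * divSym + divSym := by
  simp only [divSym_eq, Finset.mul_sum, Finset.sum_mul, mul_assoc, xiPd_xiEuler, mul_add,
    Finset.sum_add_distrib]
  simp only [← mul_assoc, coeffPd_xiEuler]

theorem xiPd_divSym {d : ℕ} (k : Fin d) : xiPd k * divSym = divSym * xiPd k := by
  simp only [divSym_eq, Finset.mul_sum, Finset.sum_mul, mul_assoc, ← xiPd_comm k]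
  simp only [← mul_assoc, xiPd_coeffPd]

theorem coeffPd_divSym {d : ℕ} (k : Fin d) : coeffPd k * divSym = divSym * coeffPd k := by
  simp only [divSym_eq, Finset.mul_sum, Finset.sum_mul, mul_assoc, xiPd_coeffPd]
  simp only [← mul_assoc, coeffPd_comm k]

theorem xiEuler_mulSym {d : ℕ} (f : Smooth d) : xiEuler d * mulSym f = mulSym f * xiEuler d := by
  simp only [xiEuler, Finset.mul_sum, Finset.sum_mul, mul_assoc, xiPd_mulSym]
  simp only [← mul_assoc, xiMul_mulSym]

variable {d : ℕ} {y : Fin d → Smooth d} (hy : ∀ j i, pd j (y i) = if j = i then 1 else 0)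
include hy

/-- Only `∂_j y^i = δ_{ij}` is used, so the relations apply both to the standard coordinates, where
equivariance of `Q_μ` is checked, and to coordinates centred at any point, as the Schur lemma needs.
-/
theorem coeffPd_mul_coord (j i : Fin d) :
    coeffPd j * mulSym (y i) = mulSym (y i) * coeffPd j + if j = i then 1 else 0 := by
  rw [coeffPd_mulSym, hy]
  split_ifs
  · rw [mulSym_one]
  · rw [mulSym_zero]

theorem coeffPd_baseEuler (j : Fin d) :
    coeffPd j * baseEuler y = baseEuler y * coeffPd j + coeffPd j := by
  simp only [baseEuler, Finset.mul_sum, Finset.sum_mul, ← mul_assoc, coeffPd_mul_coord hy, add_mul,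
    Finset.sum_add_distrib, ite_mul, one_mul, zero_mul, Finset.sum_ite_eq, Finset.mem_univ, if_true]
  simp only [mul_assoc, coeffPd_comm j]

theorem baseEuler_mul_coord (k : Fin d) :
    baseEuler y * mulSym (y k) = mulSym (y k) * baseEuler y + mulSym (y k) := by
  simp only [baseEuler, Finset.mul_sum, Finset.sum_mul, mul_assoc, coeffPd_mul_coord hy, mul_add,
    Finset.sum_add_distrib, mul_ite, mul_one, mul_zero, Finset.sum_ite_eq', Finset.mem_univ, if_true]
  simp only [← mul_assoc, mulSym_comm (y k)]

omit hy in
theorem xiPd_baseEuler (j : Fin d) : xiPd j * baseEuler y = baseEuler y * xiPd j := by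
  simp only [baseEuler, Finset.mul_sum, Finset.sum_mul, ← mul_assoc, xiPd_mulSym]
  simp only [mul_assoc, xiPd_coeffPd]

omit hy in
theorem xiPd_pairMul (j : Fin d) : xiPd j * pairMul y = pairMul y * xiPd j + mulSym (y j) := by
  simp only [pairMul, Finset.mul_sum, Finset.sum_mul, ← mul_assoc, xiPd_mulSym]
  simp only [mul_assoc, xiPd_xiMul, mul_add, Finset.sum_add_distrib, mul_ite, mul_one, mul_zero,
    Finset.sum_ite_eq, Finset.mem_univ, if_true]

theorem coeffPd_pairMul (j : Fin d) : coeffPd j * pairMul y = pairMul y * coeffPd j + xiMul j := by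
  simp only [pairMul, Finset.mul_sum, Finset.sum_mul, ← mul_assoc, coeffPd_mul_coord hy, add_mul,
    Finset.sum_add_distrib, ite_mul, one_mul, zero_mul, Finset.sum_ite_eq, Finset.mem_univ, if_true]
  simp only [mul_assoc, coeffPd_xiMul]

theorem divSym_baseEuler : divSym * baseEuler y = baseEuler y * divSym + divSym := by
  simp only [divSym_eq, Finset.mul_sum, Finset.sum_mul, mul_assoc, xiPd_baseEuler]
  simp only [← mul_assoc, coeffPd_baseEuler hy, add_mul, Finset.sum_add_distrib]

theorem divSym_mul_coord (k : Fin d) :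
    divSym * mulSym (y k) = mulSym (y k) * divSym + xiPd k := by
  simp only [divSym_eq, Finset.mul_sum, Finset.sum_mul, mul_assoc, xiPd_mulSym]
  simp only [← mul_assoc, coeffPd_mul_coord hy, add_mul, Finset.sum_add_distrib, ite_mul, one_mul,
    zero_mul, Finset.sum_ite_eq', Finset.mem_univ, if_true]

/-- For each `j`, moving `∂/∂ξ_j` and `∂/∂x^j` past `∑ y^i ξ_i` leaves one term of each Euler
operator and a `1`. The ones add up to `d`, the source of the dimension in the denominators of
`quantCoeff`. -/
theorem divSym_pairMul :
    divSym * pairMul y = pairMul y * divSym + xiEuler d + baseEuler y + (d : Module.End ℝ (Sym d)) := by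
  have h : ∀ j, coeffPd j * (xiPd j * pairMul y) = pairMul y * (coeffPd j * xiPd j)
      + xiMul j * xiPd j + mulSym (y j) * coeffPd j + 1 := by
    intro j
    rw [xiPd_pairMul, mul_add, ← mul_assoc, coeffPd_pairMul hy, coeffPd_mul_coord hy, if_pos rfl]
    noncomm_ring
  simp only [divSym_eq, Finset.mul_sum, Finset.sum_mul, mul_assoc, h, Finset.sum_add_distrib,
    xiEuler, baseEuler]
  simp

/-- The Lie derivative of symbols along `y^k ∑ y^i ∂_i`. -/
def lieSpecial {d : ℕ} (y : Fin d → Smooth d) (k : Fin d) : Module.End ℝ (Sym d) :=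
  mulSym (y k) * baseEuler y - pairMul y * xiPd k - mulSym (y k) * xiEuler d

/-- The contributions containing `baseEuler y` from the first two summands of `lieSpecial` cancel.
The defect thus involves no derivative in `x`, and on a fixed rank it is a multiple of `∂/∂ξ_k`, the
same shape as the defect of normal ordering. -/
theorem divSym_lieSpecial (k : Fin d) :
    divSym * lieSpecial y k = lieSpecial y k * divSym
      - (2 * xiEuler d + (d : Module.End ℝ (Sym d)) + 1) * xiPd k := by
  have h1 : divSym * (mulSym (y k) * baseEuler y)
      = mulSym (y k) * baseEuler y * divSym + mulSym (y k) * divSym + baseEuler y * xiPd k := by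
    rw [← mul_assoc, divSym_mul_coord hy, add_mul, mul_assoc, divSym_baseEuler hy, xiPd_baseEuler]
    noncomm_ring
  have h2 : divSym * (mulSym (y k) * xiEuler d)
      = mulSym (y k) * xiEuler d * divSym + mulSym (y k) * divSym + xiEuler d * xiPd k
        + xiPd k := by
    rw [← mul_assoc, divSym_mul_coord hy, add_mul, mul_assoc, divSym_xiEuler, xiPd_xiEuler]
    noncomm_ring
  have h3 : divSym * (pairMul y * xiPd k) = pairMul y * xiPd k * divSym + xiEuler d * xiPd k
        + baseEuler y * xiPd k + (d : Module.End ℝ (Sym d)) * xiPd k := by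
    rw [← mul_assoc, divSym_pairMul hy, add_mul, add_mul, add_mul, mul_assoc, ← xiPd_divSym]
    noncomm_ring
  rw [lieSpecial, mul_sub, mul_sub, h1, h2, h3, two_mul]
  simp only [add_mul, sub_mul, mul_assoc, one_mul]
  abel

/-- The contraction of `∂/∂x` with `∂/∂ξ` is invariant under linear changes of coordinates;
infinitesimally, both summands leave the same term `∂_i ∂/∂ξ_j`. -/
theorem divSym_linear (j i : Fin d) :
    divSym * (mulSym (y j) * coeffPd i - xiMul i * xiPd j)
      = (mulSym (y j) * coeffPd i - xiMul i * xiPd j) * divSym := by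
  have h1 : divSym * (mulSym (y j) * coeffPd i)
      = mulSym (y j) * coeffPd i * divSym + coeffPd i * xiPd j := by
    rw [← mul_assoc, divSym_mul_coord hy, add_mul, mul_assoc, ← coeffPd_divSym, xiPd_coeffPd,
      mul_assoc]
  have h2 : divSym * (xiMul i * xiPd j) = xiMul i * xiPd j * divSym + coeffPd i * xiPd j := by
    have : divSym * xiMul (d := d) i = xiMul i * divSym + coeffPd i := by
      simp only [divSym_eq, Finset.mul_sum, Finset.sum_mul, mul_assoc, xiPd_xiMul, mul_add,
        Finset.sum_add_distrib, mul_ite, mul_one, mul_zero, Finset.sum_ite_eq', Finset.mem_univ,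
        if_true]
      simp only [← mul_assoc, coeffPd_xiMul]
    rw [← mul_assoc, this, add_mul, mul_assoc, ← xiPd_divSym, mul_assoc]
  rw [mul_sub, sub_mul, h1, h2]
  abel

end Coordinates

/-! ### Lie derivatives of symbols -/

theorem mulSym_smul {d : ℕ} (c : ℝ) (f : Smooth d) : mulSym (c • f) = c • mulSym f := by
  refine LinearMap.ext fun S => ?_
  rw [LinearMap.smul_apply, ← smul_sym, ← smul_sym, smul_assoc]

theorem mulOp_smul {d : ℕ} (c : ℝ) (f : Smooth d) : mulOp (c • f) = c • mulOp f :=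
  LinearMap.ext fun g => smul_mul_assoc c f g

theorem mulOp_add {d : ℕ} (f g : Smooth d) : mulOp (f + g) = mulOp f + mulOp g :=
  LinearMap.ext fun h => add_mul f g h

theorem mulOp_zero {d : ℕ} : mulOp (0 : Smooth d) = 0 :=
  LinearMap.ext fun h => zero_mul h

/-- The Lie derivative of symbols as an operator depending linearly on the vector field. -/
def lieSymHom (d : ℕ) : VField d →ₗ[ℝ] Module.End ℝ (Sym d) where
  toFun Y := ∑ i, mulSym (Y i) * coeffPd i - ∑ i, ∑ j, mulSym (pd j (Y i)) * (xiMul i * xiPd j)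
  map_add' Y Z := by
    simp only [Pi.add_apply, map_add, mulSym_add, add_mul, Finset.sum_add_distrib]
    abel
  map_smul' c Y := by
    simp only [Pi.smul_apply, map_smul, mulSym_smul, smul_mul_assoc, ← Finset.smul_sum, smul_sub,
      RingHom.id_apply]

theorem lieSymHom_apply {d : ℕ} (Y : VField d) (S : Sym d) : lieSymHom d Y S = lieSym Y S := by
  simp only [lieSymHom, lieSym, LinearMap.coe_mk, AddHom.coe_mk, LinearMap.sub_apply,
    LinearMap.sum_apply, Module.End.mul_apply, smul_sym, xiMul_apply]

/-- The Lie derivative of densities depends linearly on the vector field. -/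
def lieDerHom (d : ℕ) (mu : ℝ) : VField d →ₗ[ℝ] Op d where
  toFun := lieDer mu
  map_add' Y Z := by
    simp only [lieDer, Pi.add_apply, map_add, mulOp_add, add_mul, Finset.sum_add_distrib, smul_add]
    abel
  map_smul' c Y := by
    simp only [lieDer, Pi.smul_apply, map_smul, mulOp_smul, smul_mul_assoc, Finset.smul_sum,
      smul_add, RingHom.id_apply, smul_comm mu c]

/-- `ad_X Δ` depends linearly on `X`. -/
def adHom {d : ℕ} (mu : ℝ) (L : Op d) : VField d →ₗ[ℝ] Op d :=
  (LinearMap.mulRight ℝ L - LinearMap.mulLeft ℝ L) ∘ₗ lieDerHom d mu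

theorem adHom_apply {d : ℕ} (mu : ℝ) (Y : VField d) (L : Op d) : adHom mu L Y = adOp mu Y L := rfl

theorem lieSymHom_single_one {d : ℕ} (i : Fin d) : lieSymHom d (Pi.single i 1) = coeffPd i := by
  have h1 : ∀ l, mulSym ((Pi.single i 1 : VField d) l) = if i = l then 1 else 0 := by
    intro l
    by_cases h : i = l
    · subst h; simp [mulSym_one]
    · simp [h, mulSym_zero]
  have h2 : ∀ l j, pd j ((Pi.single i 1 : VField d) l) = 0 := by
    intro l j
    by_cases h : i = l
    · subst h; simp [pd_one]
    · simp [h]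
  simp [lieSymHom, h1, h2, mulSym_zero]

/-! ### Lie derivatives along linear and special projective fields -/

section Coordinates

variable {d : ℕ} {y : Fin d → Smooth d} (hy : ∀ j i, pd j (y i) = if j = i then 1 else 0)
include hy

theorem lieSymHom_linear (j i : Fin d) :
    lieSymHom d (Pi.single i (y j)) = mulSym (y j) * coeffPd i - xiMul i * xiPd j := by
  have h1 : ∀ l, mulSym ((Pi.single i (y j) : VField d) l) = if i = l then mulSym (y j) else 0 := by
    intro l
    by_cases h : i = l
    · subst h; simp
    · simp [h, mulSym_zero]
  have h2 : ∀ l m, mulSym (pd m ((Pi.single i (y j) : VField d) l))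
      = if i = l then (if m = j then 1 else 0) else 0 := by
    intro l m
    by_cases h : i = l
    · subst h
      rw [Pi.single_eq_same, hy, if_pos rfl]
      split_ifs <;> simp [mulSym_one, mulSym_zero]
    · simp [h, mulSym_zero]
  simp only [lieSymHom, LinearMap.coe_mk, AddHom.coe_mk, h1, h2, ite_mul, zero_mul, one_mul,
    Finset.sum_ite_eq, Finset.mem_univ, if_true]
  rw [Finset.sum_comm]
  simp

theorem lieSymHom_special (k : Fin d) : lieSymHom d (fun i => y k * y i) = lieSpecial y k := by
  have h1 : ∀ i j, mulSym (pd j (y k * y i))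
      = mulSym (y k) * (if j = i then 1 else 0) + mulSym (y i) * (if j = k then 1 else 0) := by
    intro i j
    rw [pd_mul, hy, hy, mulSym_add, mulSym_mul, mul_comm _ (y i), mulSym_mul]
    congr 2 <;> split_ifs <;> simp [mulSym_one, mulSym_zero]
  simp only [lieSymHom, LinearMap.coe_mk, AddHom.coe_mk, h1, mulSym_mul, add_mul,
    Finset.sum_add_distrib, mul_ite, ite_mul, mul_one, mul_zero, zero_mul, Finset.sum_ite_eq',
    Finset.mem_univ, if_true, lieSpecial, baseEuler, pairMul, xiEuler, Finset.mul_sum,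
    Finset.sum_mul, mul_assoc]
  abel

theorem lieDer_linear (mu : ℝ) (j i : Fin d) :
    lieDer mu (Pi.single i (y j)) = mulOp (y j) * pd i + mu • (if i = j then 1 else 0) := by
  rw [lieDer, Finset.sum_eq_single i]
  · rw [Pi.single_eq_same, hy]
    split_ifs <;> simp [mulOp_one, mulOp_zero]
  · intro l _ hl
    simp [Pi.single_eq_of_ne hl, mulOp_zero]
  · simp

/-- The divergence of `y^k y^i ∂_i` is `(d+1) y^k`: this is where `(d+1)μ` comes from. -/
theorem lieDer_special (mu : ℝ) (k : Fin d) :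
    lieDer mu (fun i => y k * y i)
      = mulOp (y k) * ∑ i, mulOp (y i) * pd i + (((d + 1 : ℝ)) * mu) • mulOp (y k) := by
  have h1 : ∀ i, mulOp (pd i (y k * y i)) = mulOp (y k) + if i = k then mulOp (y k) else 0 := by
    intro i
    rw [pd_mul, hy, hy, if_pos rfl, mul_one, mulOp_add]
    by_cases h : i = k
    · subst h; simp
    · simp [h, mulOp_zero]
  simp only [lieDer, h1, ← mulOp_mul, smul_add, Finset.sum_add_distrib, Finset.mul_sum, mul_assoc,
    smul_ite, smul_zero, Finset.sum_ite_eq', Finset.mem_univ, if_true, Finset.sum_const,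
    Finset.card_univ, Fintype.card_fin]
  rw [← Nat.cast_smul_eq_nsmul ℝ, smul_smul, add_mul, one_mul, add_smul]

end Coordinates

/-! ### Normal ordering -/

/-- `∂^α` for a multi-index `α`. -/
def pdPow {d : ℕ} (α : Fin d →₀ ℕ) : Op d := (List.ofFn fun i => (pd i : Op d) ^ α i).prod

theorem normalOrder_monomial {d : ℕ} (α : Fin d →₀ ℕ) (a : Smooth d) :
    normalOrder (monomial α a) = mulOp a * pdPow α := by
  rw [normalOrder, symLift_monomial]; rfl

theorem pdPow_zero {d : ℕ} : pdPow (0 : Fin d →₀ ℕ) = 1 := by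
  simp [pdPow, List.ofFn_eq_map]

/-- `pdPow` is an ordered product. Stating the effect of one more `∂_i` for an arbitrary
duplicate-free list, with an indicator of `i ∈ l`, makes an induction on the list possible. -/
theorem prod_pd_pow_add_single {d : ℕ} (α : Fin d →₀ ℕ) (i : Fin d) (l : List (Fin d))
    (hl : l.Nodup) :
    (l.map fun j => (pd j : Op d) ^ (α + Finsupp.single i 1 : Fin d →₀ ℕ) j).prod
      = (l.map fun j => (pd j : Op d) ^ α j).prod * if i ∈ l then pd i else 1 := by
  have hcomm : ∀ l : List (Fin d), Commute (pd i) (l.map fun j => (pd j : Op d) ^ α j).prod := by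
    intro l
    refine Commute.list_prod_right _ _ fun x hx => ?_
    obtain ⟨j, _, rfl⟩ := List.mem_map.1 hx
    exact Commute.pow_right (pd_comm i j) _
  induction l with
  | nil => simp
  | cons j l ih =>
    rw [List.nodup_cons] at hl
    rw [List.map_cons, List.prod_cons, List.map_cons, List.prod_cons, ih hl.2]
    by_cases h : i = j
    · subst h
      rw [if_neg hl.1, if_pos (by simp), Finsupp.add_apply, Finsupp.single_eq_same, pow_succ,
        mul_one, mul_assoc, mul_assoc, (hcomm l).eq]
    · rw [Finsupp.add_apply, Finsupp.single_eq_of_ne' h, add_zero, mul_assoc]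
      simp [h]

theorem pdPow_add_single {d : ℕ} (α : Fin d →₀ ℕ) (i : Fin d) :
    pdPow (α + Finsupp.single i 1) = pdPow α * pd i := by
  have := prod_pd_pow_add_single α i (List.finRange d) (List.nodup_finRange d)
  simpa [pdPow, List.ofFn_eq_map] using this

theorem normalOrder_mulSym {d : ℕ} (f : Smooth d) (S : Sym d) :
    normalOrder (mulSym f S) = mulOp f * normalOrder S := by
  induction S using MvPolynomial.induction_on' with
  | monomial u a =>
    rw [mulSym_apply, MvPolynomial.C_mul_monomial, normalOrder_monomial, normalOrder_monomial,
      ← mulOp_mul, mul_assoc]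
  | add p q hp hq => rw [map_add, map_add, map_add, mul_add, hp, hq]

theorem normalOrder_xiMul {d : ℕ} (i : Fin d) (S : Sym d) :
    normalOrder (xiMul i S) = normalOrder S * pd i := by
  induction S using MvPolynomial.induction_on' with
  | monomial u a =>
    rw [xiMul_apply, MvPolynomial.X, MvPolynomial.monomial_mul, one_mul, normalOrder_monomial,
      normalOrder_monomial, add_comm, pdPow_add_single, mul_assoc]
  | add p q hp hq => rw [map_add, map_add, map_add, add_mul, hp, hq]

theorem sym_induction {d : ℕ} {p : Sym d → Prop} (hC : ∀ a, p (C a))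
    (hadd : ∀ S T, p S → p T → p (S + T)) (hX : ∀ i S, p S → p (xiMul i S)) (S : Sym d) : p S := by
  induction S using MvPolynomial.induction_on with
  | C a => exact hC a
  | add S T hS hT => exact hadd S T hS hT
  | mul_X S i hS => rw [mul_comm]; exact hX i S hS

theorem normalOrder_C {d : ℕ} (a : Smooth d) : normalOrder (C a) = mulOp a := by
  rw [← MvPolynomial.monomial_zero', normalOrder_monomial, pdPow_zero, mul_one]

/-- Symbol calculus for composition on the left: by the Leibniz rule `∂_i` becomes `ξ_i + ∂/∂x^i`.
-/
theorem pd_mul_normalOrder {d : ℕ} (i : Fin d) (S : Sym d) :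
    pd i * normalOrder S = normalOrder (xiMul i S + coeffPd i S) := by
  rw [map_add, normalOrder_xiMul]
  induction S using sym_induction with
  | hC a =>
    rw [normalOrder_C, pd_mulOp, ← MvPolynomial.monomial_zero', coeffPd_monomial,
      MvPolynomial.monomial_zero', normalOrder_C]
  | hadd S T hS hT => simp only [map_add, mul_add, add_mul, hS, hT]; abel
  | hX j S hS =>
    rw [normalOrder_xiMul, ← mul_assoc, hS, show coeffPd i (xiMul j S) = xiMul j (coeffPd i S) from
      LinearMap.congr_fun (coeffPd_xiMul i j) S, normalOrder_xiMul, add_mul, mul_assoc, mul_assoc,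
      pd_comm i j]

/-- Symbol calculus for composition on the right: `y^i` becomes `y^i + ∂/∂ξ_i`. There are no further
terms because the derivatives of `y^i` are constant. -/
theorem normalOrder_mul_mulOp {d : ℕ} {y : Fin d → Smooth d}
    (hy : ∀ j i, pd j (y i) = if j = i then 1 else 0) (i : Fin d) (S : Sym d) :
    normalOrder S * mulOp (y i) = normalOrder (mulSym (y i) S + xiPd i S) := by
  rw [map_add, normalOrder_mulSym]
  induction S using sym_induction with
  | hC a =>
    rw [normalOrder_C, mulOp_mul, mulOp_mul, mul_comm, xiPd_apply, MvPolynomial.pderiv_C, map_zero,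
      add_zero]
  | hadd S T hS hT => simp only [map_add, mul_add, add_mul, hS, hT]; abel
  | hX j S hS =>
    rw [normalOrder_xiMul, mul_assoc, pd_mulOp, mul_add, ← mul_assoc, hS,
      show xiPd i (xiMul j S) = xiMul j (xiPd i S) + (if i = j then 1 else 0 : Module.End ℝ (Sym d)) S
        from LinearMap.congr_fun (xiPd_xiMul i j) S, hy, map_add, normalOrder_xiMul, add_mul,
      mul_assoc, add_assoc]
    by_cases h : i = j
    · subst h; simp [mulOp_one]
    · simp [h, Ne.symm h, mulOp_zero]

/-- Normal ordering intertwines the actions of linear vector fields. -/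
theorem adOp_linear_normalOrder {d : ℕ} {y : Fin d → Smooth d}
    (hy : ∀ j i, pd j (y i) = if j = i then 1 else 0) (mu : ℝ) (j i : Fin d) (S : Sym d) :
    adOp mu (Pi.single i (y j)) (normalOrder S)
      = normalOrder (lieSymHom d (Pi.single i (y j)) S) := by
  have h0 : ∀ L : Op d, (mu • (if i = j then 1 else 0 : Op d)) * L
      = L * (mu • (if i = j then 1 else 0 : Op d)) := by
    intro L; split_ifs <;> simp
  rw [adOp, lieDer_linear hy, add_mul, mul_add, h0, add_sub_add_right_eq_sub, mul_assoc,
    pd_mul_normalOrder, ← normalOrder_mulSym, ← mul_assoc, normalOrder_mul_mulOp hy,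
    ← normalOrder_xiMul, ← map_sub, lieSymHom_linear hy]
  congr 1
  simp only [LinearMap.sub_apply, Module.End.mul_apply, map_add]
  rw [show xiMul i (mulSym (y j) S) = mulSym (y j) (xiMul i S) from
    LinearMap.congr_fun (xiMul_mulSym i (y j)) S]
  abel

theorem adOp_translation_normalOrder {d : ℕ} (mu : ℝ) (i : Fin d) (S : Sym d) :
    adOp mu (Pi.single i 1) (normalOrder S) = normalOrder (lieSymHom d (Pi.single i 1) S) := by
  have h : lieDer mu (Pi.single i 1 : VField d) = pd i := by
    rw [lieDer, Finset.sum_eq_single i]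
    · simp [mulOp_one, pd_one, mulOp_zero]
    · intro l _ hl
      simp [Pi.single_eq_of_ne hl, mulOp_zero]
    · simp
  rw [adOp, h, pd_mul_normalOrder, map_add, normalOrder_xiMul, lieSymHom_single_one]
  abel

/-- The failure of normal ordering to intertwine the special projective fields. -/
theorem adOp_special_normalOrder {d : ℕ} {y : Fin d → Smooth d}
    (hy : ∀ j i, pd j (y i) = if j = i then 1 else 0) (mu : ℝ) (k : Fin d) (S : Sym d) :
    adOp mu (fun i => y k * y i) (normalOrder S)
      = normalOrder (lieSpecial y k S - (xiEuler d + ((d + 1 : ℝ) * mu) • 1) (xiPd k S)) := by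
  have h1 : (∑ i, mulOp (y i) * pd i) * normalOrder S
      = normalOrder (pairMul y S + baseEuler y S) := by
    simp only [Finset.sum_mul, mul_assoc, pd_mul_normalOrder, pairMul, baseEuler,
      LinearMap.sum_apply, Module.End.mul_apply, map_add, map_sum, normalOrder_mulSym, mul_add,
      Finset.sum_add_distrib]
  have h2 : ∀ T : Sym d, normalOrder T * (∑ i, mulOp (y i) * pd i)
      = normalOrder (pairMul y T + xiEuler d T) := by
    intro T
    have : ∀ i, normalOrder T * (mulOp (y i) * pd i)
        = normalOrder (mulSym (y i) (xiMul i T)) + normalOrder (xiMul i (xiPd i T)) := by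
      intro i
      rw [← mul_assoc, normalOrder_mul_mulOp hy, ← normalOrder_xiMul, map_add, map_add,
        show xiMul i (mulSym (y i) T) = mulSym (y i) (xiMul i T) from
          LinearMap.congr_fun (xiMul_mulSym i (y i)) T]
    simp only [Finset.mul_sum, this, pairMul, xiEuler, LinearMap.sum_apply, Module.End.mul_apply,
      Finset.sum_add_distrib, map_sum, map_add]
  have e1 : pairMul y (mulSym (y k) S) = mulSym (y k) (pairMul y S) := by
    refine LinearMap.congr_fun (f := pairMul y * mulSym (y k)) (g := mulSym (y k) * pairMul y) ?_ S
    simp only [pairMul, Finset.mul_sum, Finset.sum_mul, mul_assoc, xiMul_mulSym]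
    simp only [← mul_assoc, mulSym_comm (y k)]
  have e2 : xiEuler d (mulSym (y k) S) = mulSym (y k) (xiEuler d S) :=
    LinearMap.congr_fun (xiEuler_mulSym (y k)) S
  -- Composition with `y^k` on the right replaces `S` by `y^k S + ∂S/∂ξ_k`. The terms `y^k (∑ y^i
  -- ξ_i) S` and the weight terms in `y^k S` cancel; beyond `lieSpecial` there remain the Euler and
  -- weight terms applied to `∂S/∂ξ_k`.
  rw [adOp, lieDer_special hy, add_mul, mul_add, mul_assoc, h1, ← normalOrder_mulSym,
    ← mul_assoc, normalOrder_mul_mulOp hy, h2, smul_mul_assoc, mul_smul_comm,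
    normalOrder_mul_mulOp hy, ← normalOrder_mulSym, ← map_smul, ← map_smul, ← map_add, ← map_add,
    ← map_smul normalOrder, ← map_add, ← map_sub, lieSpecial]
  congr 1
  simp only [LinearMap.sub_apply, LinearMap.add_apply, LinearMap.smul_apply, Module.End.mul_apply,
    Module.End.one_apply, map_add, map_smul, e1, e2, smul_add]
  abel

/-! ### Homogeneous components -/

/-- The rank-`k` part of a symbol. -/
def rankPart {d : ℕ} (k : ℕ) : Module.End ℝ (Sym d) := (homogeneousComponent k).restrictScalars ℝ

theorem rankPart_apply {d : ℕ} (k : ℕ) (S : Sym d) : rankPart k S = homogeneousComponent k S := rfl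

theorem coeff_rankPart {d : ℕ} (k : ℕ) (S : Sym d) (α : Fin d →₀ ℕ) :
    (rankPart k S).coeff α = if α.degree = k then S.coeff α else 0 := by
  rw [rankPart_apply, MvPolynomial.coeff_homogeneousComponent]

theorem rankPart_monomial {d : ℕ} (k : ℕ) (α : Fin d →₀ ℕ) (a : Smooth d) :
    rankPart k (monomial α a) = if α.degree = k then monomial α a else 0 := by
  ext β : 1
  rw [coeff_rankPart, MvPolynomial.coeff_monomial]
  by_cases h : α = β
  · subst h; rw [if_pos rfl]; split_ifs <;> simp
  · split_ifs <;> simp [h]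

theorem rankPart_rankPart {d : ℕ} (j k : ℕ) (S : Sym d) :
    rankPart j (rankPart k S) = if j = k then rankPart k S else 0 := by
  ext α : 1
  simp only [coeff_rankPart]
  by_cases h : j = k
  · subst h; simp only [if_true, coeff_rankPart]; split_ifs <;> rfl
  · rw [if_neg h, MvPolynomial.coeff_zero]
    split_ifs with h1 h2
    · exact absurd (h1.symm.trans h2) h
    · rfl
    · rfl

theorem totalDegree_rankPart_le {d : ℕ} (k : ℕ) (S : Sym d) : (rankPart k S).totalDegree ≤ k :=
  (MvPolynomial.homogeneousComponent_isHomogeneous k S).totalDegree_le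

theorem totalDegree_le_iff_rankPart {d : ℕ} (n : ℕ) (S : Sym d) :
    S.totalDegree ≤ n ↔ ∀ m, n < m → rankPart m S = 0 := by
  constructor
  · intro h m hm
    exact MvPolynomial.homogeneousComponent_eq_zero m S (h.trans_lt hm)
  · intro h
    refine Finset.sup_le fun α hα => ?_
    change α.degree ≤ n
    by_contra hc
    have := coeff_rankPart α.degree S α
    rw [h _ (not_le.1 hc), if_pos rfl, MvPolynomial.coeff_zero] at this
    exact MvPolynomial.mem_support_iff.1 hα this.symm

theorem sum_rankPart {d n : ℕ} {S : Sym d} (h : S.totalDegree ≤ n) :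
    ∑ k ∈ Finset.range (n + 1), rankPart k S = S := by
  ext α : 1
  rw [MvPolynomial.coeff_sum]
  simp only [coeff_rankPart, Finset.sum_ite_eq, Finset.mem_range]
  split_ifs with hα
  · rfl
  · by_contra hc
    have : α.degree ≤ S.totalDegree :=
      MvPolynomial.le_totalDegree (MvPolynomial.mem_support_iff.2 (Ne.symm hc))
    omega

theorem rankPart_mulSym {d : ℕ} (k : ℕ) (f : Smooth d) :
    rankPart k * mulSym f = mulSym f * rankPart k := by
  refine LinearMap.ext fun S => ?_
  exact MvPolynomial.homogeneousComponent_C_mul S k f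

theorem rankPart_coeffPd {d : ℕ} (k : ℕ) (i : Fin d) :
    rankPart k * coeffPd i = coeffPd i * rankPart k := by
  refine sym_hom_ext fun α a => ?_
  simp only [Module.End.mul_apply, coeffPd_monomial, rankPart_monomial]
  split_ifs <;> simp [coeffPd_monomial]

theorem rankPart_xiMul {d : ℕ} (k : ℕ) (i : Fin d) :
    rankPart (k + 1) * xiMul i = xiMul i * rankPart k := by
  refine sym_hom_ext fun α a => ?_
  have h : ∀ b : Smooth d, xiMul i (monomial α b) = monomial (Finsupp.single i 1 + α) b := by
    intro b; rw [xiMul_apply, MvPolynomial.X, MvPolynomial.monomial_mul, one_mul]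
  simp only [Module.End.mul_apply, h, rankPart_monomial, map_add, Finsupp.degree_single]
  by_cases hk : α.degree = k
  · rw [if_pos (by omega), if_pos hk, h]
  · rw [if_neg (by omega), if_neg hk, map_zero]

theorem rankPart_xiPd {d : ℕ} (k : ℕ) (i : Fin d) :
    rankPart k * xiPd i = xiPd i * rankPart (k + 1) := by
  refine sym_hom_ext fun α a => ?_
  simp only [Module.End.mul_apply, rankPart_monomial, xiPd_apply, MvPolynomial.pderiv_monomial]
  -- When `α i = 0` the truncated difference `α - single i 1` has the wrong degree, but its
  -- coefficient is zero.
  by_cases h0 : α i = 0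
  · split_ifs <;> simp [h0]
  · have hle : Finsupp.single i 1 ≤ α := by
      rw [Finsupp.single_le_iff]; omega
    have hd : (α - Finsupp.single i 1).degree + 1 = α.degree := by
      conv_rhs => rw [← tsub_add_cancel_of_le hle, map_add, Finsupp.degree_single]
    by_cases hk : α.degree = k + 1
    · rw [if_pos (by omega), if_pos hk, MvPolynomial.pderiv_monomial]
    · rw [if_neg (by omega), if_neg hk, map_zero]

theorem rankPart_divSym {d : ℕ} (k : ℕ) :
    rankPart k * divSym = divSym * rankPart (d := d) (k + 1) := by
  simp only [divSym_eq, Finset.mul_sum, Finset.sum_mul, ← mul_assoc, rankPart_coeffPd]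
  simp only [mul_assoc, rankPart_xiPd]

theorem rankPart_divSym_pow {d : ℕ} (k r : ℕ) :
    rankPart k * divSym ^ r = divSym ^ r * rankPart (d := d) (k + r) := by
  induction r generalizing k with
  | zero => simp
  | succ r ih => rw [pow_succ', ← mul_assoc, rankPart_divSym, mul_assoc, ih, ← mul_assoc,
      add_right_comm, add_assoc]

theorem rankPart_xiMul_xiPd {d : ℕ} (k : ℕ) (i j : Fin d) :
    rankPart k * (xiMul i * xiPd j) = xiMul i * xiPd j * rankPart k := by
  cases k with
  -- There is no rank `-1` to pass through; both sides vanish.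
  | zero =>
    refine sym_hom_ext fun α a => ?_
    simp only [Module.End.mul_apply]
    have h1 : ∀ S, rankPart 0 (xiMul i S : Sym d) = 0 := fun S => by
      rw [rankPart_apply, MvPolynomial.homogeneousComponent_zero, xiMul_apply,
        ← MvPolynomial.constantCoeff_eq, map_mul, MvPolynomial.constantCoeff_X, zero_mul, map_zero]
    have h2 : ∀ S : Sym d, xiPd j (rankPart 0 S) = 0 := fun S => by
      rw [rankPart_apply, MvPolynomial.homogeneousComponent_zero, xiPd_apply, MvPolynomial.pderiv_C]
    rw [h1, h2, map_zero]
  | succ k => rw [← mul_assoc, rankPart_xiMul, mul_assoc, rankPart_xiPd, mul_assoc]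

theorem rankPart_lieSymHom {d : ℕ} (k : ℕ) (Y : VField d) :
    rankPart k * lieSymHom d Y = lieSymHom d Y * rankPart k := by
  simp only [lieSymHom, LinearMap.coe_mk, AddHom.coe_mk, mul_sub, sub_mul, Finset.mul_sum,
    Finset.sum_mul, ← mul_assoc, rankPart_mulSym]
  simp only [mul_assoc, rankPart_coeffPd]
  simp only [← mul_assoc]
  simp only [mul_assoc, rankPart_xiMul_xiPd]

/-- The operators `ξ_i ∂/∂ξ_i` are diagonal on monomials and their joint eigenvalues are the
multi-indices, so they separate monomials in the Schur lemma. -/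
theorem coeff_xiMul_xiPd {d : ℕ} (i : Fin d) (S : Sym d) (α : Fin d →₀ ℕ) :
    (xiMul i (xiPd i S)).coeff α = (α i : ℝ) • S.coeff α := by
  induction S using MvPolynomial.induction_on' with
  | monomial u a =>
    rw [xiMul_apply, xiPd_apply, MvPolynomial.X_mul_pderiv_monomial, MvPolynomial.coeff_smul,
      MvPolynomial.coeff_monomial]
    by_cases h : u = α
    · subst h; rw [if_pos rfl, Nat.cast_smul_eq_nsmul]
    · rw [if_neg h, smul_zero, smul_zero]
  | add p q hp hq => simp only [map_add, MvPolynomial.coeff_add, hp, hq, smul_add]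

theorem coeff_xiEuler {d : ℕ} (S : Sym d) (α : Fin d →₀ ℕ) :
    (xiEuler d S).coeff α = (α.degree : ℝ) • S.coeff α := by
  simp only [xiEuler, LinearMap.sum_apply, Module.End.mul_apply, MvPolynomial.coeff_sum,
    coeff_xiMul_xiPd, ← Finset.sum_smul]
  rw [Finsupp.degree_eq_sum, Nat.cast_sum]

theorem xiEuler_rankPart {d : ℕ} (k : ℕ) (S : Sym d) :
    xiEuler d (rankPart k S) = (k : ℝ) • rankPart k S := by
  ext α : 1
  rw [coeff_xiEuler, MvPolynomial.coeff_smul, coeff_rankPart]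
  split_ifs with h
  · rw [h]
  · simp

/-- The Euler operator has only non-negative eigenvalues, so a symbol of negative rank vanishes. -/
theorem eq_zero_of_xiEuler {d : ℕ} {S : Sym d} {c : ℝ} (hc : 0 < c) (h : xiEuler d S + c • S = 0) :
    S = 0 := by
  ext α : 1
  have := congrArg (MvPolynomial.coeff α) h
  rw [MvPolynomial.coeff_add, MvPolynomial.coeff_smul, coeff_xiEuler, ← add_smul,
    MvPolynomial.coeff_zero] at this
  exact (smul_eq_zero.1 this).resolve_left (by positivity)

/-! ### Equivariance of the quantisation -/

/-- The rank is recorded as a real eigenvalue of `xiEuler`, which avoids truncated subtraction when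
it drops below zero. -/
theorem xiEuler_divSym_pow {d : ℕ} {k : ℝ} {S : Sym d} (h : xiEuler d S = k • S) (r : ℕ) :
    xiEuler d ((divSym ^ r) S) = (k - r) • (divSym ^ r) S := by
  induction r with
  | zero => simpa using h
  | succ r ih =>
    have := LinearMap.congr_fun (divSym_xiEuler (d := d)) ((divSym ^ r) S)
    rw [Module.End.mul_apply, ih, map_smul, LinearMap.add_apply, Module.End.mul_apply] at this
    rw [pow_succ', Module.End.mul_apply, ← sub_eq_iff_eq_add.2 this, Nat.cast_succ]
    module

theorem xiEuler_xiPd {d : ℕ} {k : ℝ} {S : Sym d} (h : xiEuler d S = k • S) (i : Fin d) :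
    xiEuler d (xiPd i S) = (k - 1) • xiPd i S := by
  have := LinearMap.congr_fun (xiPd_xiEuler i) S
  rw [Module.End.mul_apply, h, map_smul, LinearMap.add_apply, Module.End.mul_apply] at this
  rw [← sub_eq_iff_eq_add.2 this]
  module

/-- Iterating `divSym_lieSpecial`, the passage from power `s` to `s + 1` contributes `2(k - s - 1) +
d + 1`; summed over `s < r` this is `r(2k + d - r)`. The truncated exponent at `r = 0` is harmless
since the factor is then zero. -/
theorem divSym_pow_lieSpecial {d : ℕ} {y : Fin d → Smooth d}
    (hy : ∀ j i, pd j (y i) = if j = i then 1 else 0) (i : Fin d) {k : ℝ} {S : Sym d}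
    (h : xiEuler d S = k • S) (r : ℕ) :
    (divSym ^ r) (lieSpecial y i S) = lieSpecial y i ((divSym ^ r) S)
      - ((r : ℝ) * (2 * k + d - r)) • xiPd i ((divSym ^ (r - 1)) S) := by
  induction r with
  | zero => simp
  | succ r ih =>
    have h1 : divSym (lieSpecial y i ((divSym ^ r) S)) = lieSpecial y i ((divSym ^ (r + 1)) S)
        - (2 * (k - r - 1) + d + 1) • xiPd i ((divSym ^ r) S) := by
      have := LinearMap.congr_fun (divSym_lieSpecial hy i) ((divSym ^ r) S)
      rw [Module.End.mul_apply] at this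
      rw [this]
      simp only [LinearMap.sub_apply, LinearMap.add_apply, Module.End.mul_apply, two_mul, add_mul,
        one_mul, xiEuler_xiPd (xiEuler_divSym_pow h r), pow_succ', ← nsmul_eq_mul,
        ← Nat.cast_smul_eq_nsmul ℝ, LinearMap.smul_apply]
      module
    have h2 : ((r : ℝ) * (2 * k + d - r)) • divSym (xiPd i ((divSym ^ (r - 1)) S))
        = ((r : ℝ) * (2 * k + d - r)) • xiPd i ((divSym ^ r) S) := by
      cases r with
      | zero => simp
      | succ r =>
        have := LinearMap.congr_fun (xiPd_divSym i) ((divSym ^ r) S)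
        rw [Module.End.mul_apply, Module.End.mul_apply] at this
        rw [Nat.add_sub_cancel, ← this, pow_succ', Module.End.mul_apply]
    rw [pow_succ', Module.End.mul_apply, ih, map_sub, map_smul, h1, h2, Nat.add_sub_cancel,
      pow_succ', Nat.cast_succ]
    module

theorem quantCoeff_zero (d k : ℕ) (mu : ℝ) : quantCoeff d k 0 mu = 1 := by
  simp [quantCoeff]

/-- This is the condition for equivariance under special fields: the commutator of the `(r+1)`-st
power of the divergence has to cancel the defect of normal ordering on the `r`-th. The bound `r < k`
keeps the denominator `d + 2k - (r+1)` positive. -/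
theorem quantCoeff_succ {d k r : ℕ} (hr : r < k) (mu : ℝ) :
    quantCoeff d k (r + 1) mu * (((r + 1 : ℕ) : ℝ) * (2 * k + d - ((r + 1 : ℕ) : ℝ)))
      = quantCoeff d k r mu * ((k - r - 1) + (d + 1) * mu) := by
  have h : (d : ℝ) + 2 * k - (r + 1 : ℕ) ≠ 0 := by
    have : ((r + 1 : ℕ) : ℝ) ≤ k := by exact_mod_cast hr
    have h1 : (0 : ℝ) ≤ d := Nat.cast_nonneg d
    have h2 : (0 : ℝ) < (r + 1 : ℕ) := by positivity
    linarith
  have hf : (r.factorial : ℝ) ≠ 0 := by positivity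
  rw [quantCoeff, quantCoeff, Finset.prod_Icc_succ_top (by omega), Nat.factorial_succ]
  push_cast at h ⊢
  have hr' : (r : ℝ) + 1 ≠ 0 := by positivity
  generalize ∏ j ∈ Finset.Icc 1 r, (((d + 1 : ℝ) * mu + k - j) / ((d : ℝ) + 2 * k - j)) = p
  rw [show 2 * (k : ℝ) + d - (r + 1) = (d : ℝ) + 2 * k - (r + 1) by ring]
  generalize (d : ℝ) + 2 * k - (r + 1) = D at h ⊢
  field_simp
  ring

theorem quantRank_apply {d : ℕ} (k : ℕ) (mu : ℝ) (S : Sym d) :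
    quantRank k mu S = normalOrder
      (∑ r ∈ Finset.range (k + 1), quantCoeff d k r mu • (divSym ^ r) (rankPart k S)) := by
  simp only [quantRank, LinearMap.comp_apply, LinearMap.sum_apply, LinearMap.smul_apply, map_sum,
    map_smul]
  rfl

/-- Covers the affine fields, for which normal ordering and the divergence are separately
equivariant and the coefficients play no role. -/
theorem adOp_quantRank_of_commute {d : ℕ} (k : ℕ) (mu : ℝ) {Y : VField d}
    (hN : ∀ S : Sym d, adOp mu Y (normalOrder S) = normalOrder (lieSymHom d Y S))
    (hdiv : divSym * lieSymHom d Y = lieSymHom d Y * divSym) (S : Sym d) :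
    adOp mu Y (quantRank k mu S) = quantRank k mu (lieSymHom d Y S) := by
  have h1 : rankPart k (lieSymHom d Y S) = lieSymHom d Y (rankPart k S) :=
    LinearMap.congr_fun (rankPart_lieSymHom k Y) S
  have h2 : ∀ r T, (divSym ^ r) (lieSymHom d Y T) = lieSymHom d Y ((divSym ^ r) T) := fun r T =>
    LinearMap.congr_fun ((show Commute divSym (lieSymHom d Y) from hdiv).pow_left r).eq T
  rw [quantRank_apply, quantRank_apply, hN, h1]
  simp only [map_sum, map_smul, h2]

theorem adOp_quantRank_special {d : ℕ} {y : Fin d → Smooth d}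
    (hy : ∀ j i, pd j (y i) = if j = i then 1 else 0) (k : ℕ) (mu : ℝ) (i : Fin d) (S : Sym d) :
    adOp mu (fun l => y i * y l) (quantRank k mu S)
      = quantRank k mu (lieSymHom d (fun l => y i * y l) S) := by
  have h1 : rankPart k (lieSymHom d (fun l => y i * y l) S) = lieSpecial y i (rankPart k S) := by
    rw [← lieSymHom_special hy]
    exact LinearMap.congr_fun (rankPart_lieSymHom k _) S
  rw [quantRank_apply, quantRank_apply, adOp_special_normalOrder hy, h1]
  congr 1
  have hT : xiEuler d (rankPart k S) = (k : ℝ) • rankPart k S := xiEuler_rankPart k S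
  generalize rankPart k S = T at hT
  simp only [map_sum, map_smul, divSym_pow_lieSpecial hy i hT, smul_sub, Finset.sum_sub_distrib]
  congr 1
  -- This symbol would have rank `-1`.
  have hlast : xiPd i ((divSym ^ k) T) = 0 := by
    refine eq_zero_of_xiEuler one_pos ?_
    rw [xiEuler_xiPd (xiEuler_divSym_pow hT k), sub_self, zero_sub, neg_smul, neg_add_cancel]
  -- The defect sum loses its last term and the commutator sum its term `r = 0`; after the shift
  -- they agree term by term by `quantCoeff_succ`.
  rw [Finset.sum_range_succ, hlast, Finset.sum_range_succ' (n := k)]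
  simp only [map_zero, smul_zero, add_zero, Nat.cast_zero, zero_mul, zero_smul, Nat.add_sub_cancel]
  refine Finset.sum_congr rfl fun r hr => ?_
  rw [smul_smul, quantCoeff_succ (Finset.mem_range.1 hr), LinearMap.add_apply,
    xiEuler_xiPd (xiEuler_divSym_pow hT r), LinearMap.smul_apply, Module.End.one_apply]
  module

/-- The quantisation of symbols of rank `k` is equivariant. -/
theorem adOp_quantRank {d : ℕ} (k : ℕ) (mu : ℝ) {Y : VField d} (hY : Y ∈ projFields d) (S : Sym d) :
    adOp mu Y (quantRank k mu S) = quantRank k mu (lieSym Y S) := by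
  rw [← lieSymHom_apply, ← adHom_apply]
  have hc : ∀ j i : Fin d, pd j (coord i) = if j = i then 1 else 0 := pd_coord
  induction hY using Submodule.span_induction with
  | mem Y h =>
    rw [adHom_apply]
    rcases h with (⟨i, rfl⟩ | ⟨j, i, rfl⟩) | ⟨j, rfl⟩
    · refine adOp_quantRank_of_commute k mu (adOp_translation_normalOrder mu i) ?_ S
      rw [lieSymHom_single_one, coeffPd_divSym]
    · refine adOp_quantRank_of_commute k mu (adOp_linear_normalOrder hc mu j i) ?_ S
      rw [lieSymHom_linear hc, divSym_linear hc]
    · exact adOp_quantRank_special hc k mu j S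
  | zero => simp
  | add Y Z _ _ hY hZ => rw [map_add, hY, hZ, map_add, LinearMap.add_apply, map_add]
  | smul c Y _ hY => rw [map_smul, hY, map_smul, LinearMap.smul_apply, map_smul]

/-! ### Principal symbols and normal ordering -/

theorem coeff_zero_xiMul {d : ℕ} (i : Fin d) (S : Sym d) : (xiMul i S).coeff 0 = 0 := by
  rw [xiMul_apply, ← MvPolynomial.constantCoeff_eq, map_mul, MvPolynomial.constantCoeff_X, zero_mul]

theorem normalOrder_apply_one {d : ℕ} (S : Sym d) : normalOrder S 1 = S.coeff 0 := by
  induction S using sym_induction with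
  | hC a => rw [normalOrder_C, mulOp_apply, mul_one, MvPolynomial.coeff_zero_C]
  | hadd S T hS hT => rw [map_add, LinearMap.add_apply, hS, hT, MvPolynomial.coeff_add]
  | hX i S _ => rw [normalOrder_xiMul, Module.End.mul_apply, pd_one, map_zero, coeff_zero_xiMul]

/-- The principal symbol of rank `k` of a normally ordered symbol is its rank-`k` part. -/
theorem prinSymbol_normalOrder {d : ℕ} (k : ℕ) (S : Sym d) :
    prinSymbol k (normalOrder S) = rankPart k S := by
  induction k generalizing S with
  | zero =>
    rw [rankPart_apply, MvPolynomial.homogeneousComponent_zero, ← normalOrder_apply_one]; rfl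
  | succ k ih =>
    -- The commutator with `x^i` acts on the symbol as `∂/∂ξ_i`. Euler's identity in rank `k + 1`
    -- then recovers the symbol, and its eigenvalue cancels the factor `(k + 1)⁻¹`.
    have h : ∀ i, normalOrder S * mulOp (coord i) - mulOp (coord i) * normalOrder S
        = normalOrder (xiPd i S) := by
      intro i
      rw [normalOrder_mul_mulOp pd_coord, ← normalOrder_mulSym, map_add, add_sub_cancel_left]
    have h2 : prinSymbol (k + 1) (normalOrder S) = ((k + 1 : ℝ)⁻¹) • ∑ i, xiMul i
        (prinSymbol k (normalOrder S * mulOp (coord i) - mulOp (coord i) * normalOrder S)) := by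
      simp only [prinSymbol, LinearMap.smul_apply, LinearMap.sum_apply]; rfl
    have h3 : ∀ i, rankPart k (xiPd i S) = xiPd i (rankPart (k + 1) S) := fun i =>
      LinearMap.congr_fun (rankPart_xiPd k i) S
    have h4 := xiEuler_rankPart (k + 1) S
    simp only [xiEuler, LinearMap.sum_apply, Module.End.mul_apply] at h4
    simp only [h2, h, ih, h3, h4, smul_smul]
    rw [Nat.cast_succ, inv_mul_cancel₀ (by positivity), one_smul]

theorem normalOrder_rankPart_mem {d : ℕ} (k : ℕ) (S : Sym d) :
    normalOrder (rankPart k S) ∈ diffOp d k := by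
  induction S using sym_induction generalizing k with
  | hC a =>
    rw [← MvPolynomial.monomial_zero', rankPart_monomial]
    split_ifs with h
    · rw [MvPolynomial.monomial_zero', normalOrder_C]
      exact Submodule.subset_span ⟨a, [], by simp, by simp [pdWord]⟩
    · rw [map_zero]; exact zero_mem _
  | hadd S T hS hT => rw [map_add, map_add]; exact add_mem (hS k) (hT k)
  | hX i S hS =>
    cases k with
    | zero =>
      rw [rankPart_apply, MvPolynomial.homogeneousComponent_zero, coeff_zero_xiMul, map_zero,
        map_zero]
      exact zero_mem _
    | succ k =>
      rw [show rankPart (k + 1) (xiMul i S) = xiMul i (rankPart k S) from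
        LinearMap.congr_fun (rankPart_xiMul k i) S, normalOrder_xiMul]
      exact mem_pd i (hS k)

theorem exists_normalOrder_eq {d n : ℕ} {L : Op d} (hL : L ∈ diffOp d n) :
    ∃ S : Sym d, S.totalDegree ≤ n ∧ normalOrder S = L := by
  induction hL using Submodule.span_induction with
  | mem L h =>
    obtain ⟨a, w, hw, rfl⟩ := h
    suffices h : ∃ S : Sym d, S.totalDegree ≤ w.length ∧ normalOrder S = pdWord w by
      obtain ⟨S, hS, e⟩ := h
      refine ⟨mulSym a S, ?_, by rw [normalOrder_mulSym, e]⟩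
      refine (MvPolynomial.totalDegree_mul _ _).trans ?_
      rw [MvPolynomial.totalDegree_C]
      omega
    clear hw
    induction w with
    | nil => exact ⟨C 1, by simp, by rw [normalOrder_C, mulOp_one]; rfl⟩
    | cons i w ih =>
      obtain ⟨S, hS, e⟩ := ih
      refine ⟨xiMul i S, ?_, ?_⟩
      · refine (MvPolynomial.totalDegree_mul _ _).trans ?_
        have : (X i : Sym d).totalDegree ≤ 1 := by
          refine (MvPolynomial.totalDegree_monomial_le (Finsupp.single i 1) (1 : Smooth d)).trans ?_
          simp
        rw [List.length_cons]
        omega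
      · rw [normalOrder_xiMul, e, ← pd_pdWord]; simp [pdWord]
  | zero => exact ⟨0, by simp, map_zero _⟩
  | add L M _ _ hL hM =>
    obtain ⟨S, hS, rfl⟩ := hL
    obtain ⟨T, hT, rfl⟩ := hM
    exact ⟨S + T, (MvPolynomial.totalDegree_add S T).trans (max_le hS hT), map_add _ _ _⟩
  | smul c L _ hL =>
    obtain ⟨S, hS, rfl⟩ := hL
    exact ⟨c • S, (MvPolynomial.totalDegree_smul_le c S).trans hS, map_smul _ _ _⟩

/-! ### The quantisation and the full symbol map are mutually inverse -/

/-- The normally ordered symbol of `Q_μ` on symbols of rank `k`. -/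
def quantSym {d : ℕ} (k : ℕ) (mu : ℝ) : Module.End ℝ (Sym d) :=
  ∑ r ∈ Finset.range (k + 1), quantCoeff d k r mu • (divSym ^ r * rankPart k)

theorem quantRank_eq_normalOrder {d : ℕ} (k : ℕ) (mu : ℝ) (S : Sym d) :
    quantRank k mu S = normalOrder (quantSym k mu S) := by
  rw [quantRank_apply]
  simp only [quantSym, LinearMap.sum_apply, LinearMap.smul_apply, Module.End.mul_apply]

/-- Unitriangularity of `Q_μ`: `divSym ^ r` lowers the rank by `r`, so in rank `k` and above only `r
= 0` contributes, with coefficient `1`. -/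
theorem rankPart_quantSym {d : ℕ} {m k : ℕ} (h : k ≤ m) (mu : ℝ) (S : Sym d) :
    rankPart m (quantSym k mu S) = if m = k then rankPart k S else 0 := by
  have h1 : ∀ r, rankPart m ((divSym ^ r) (rankPart k S))
      = (divSym ^ r) (if m + r = k then rankPart k S else 0) := by
    intro r
    rw [← rankPart_rankPart]
    exact LinearMap.congr_fun (rankPart_divSym_pow m r) (rankPart k S)
  simp only [quantSym, LinearMap.sum_apply, LinearMap.smul_apply, Module.End.mul_apply, map_sum,
    map_smul, h1]
  rw [Finset.sum_eq_single 0]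
  · simp [quantCoeff_zero]
  · intro r _ hr
    rw [if_neg (by omega), map_zero, smul_zero]
  · simp

theorem prinSymbol_quantRank {d : ℕ} {m k : ℕ} (h : k ≤ m) (mu : ℝ) (S : Sym d) :
    prinSymbol m (quantRank k mu S) = if m = k then rankPart k S else 0 := by
  rw [quantRank_eq_normalOrder, prinSymbol_normalOrder, rankPart_quantSym h]

theorem quantRank_rankPart {d : ℕ} (k j : ℕ) (mu : ℝ) (S : Sym d) :
    quantRank k mu (rankPart j S) = if k = j then quantRank k mu S else 0 := by
  rw [quantRank_apply, rankPart_rankPart]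
  split_ifs with h
  · subst h; rw [quantRank_apply]
  · simp

theorem quant_apply {d : ℕ} (n : ℕ) (mu : ℝ) (S : Sym d) :
    quant n mu S = ∑ k ∈ Finset.range (n + 1), quantRank k mu S := by
  rw [quant, LinearMap.sum_apply]

theorem prinSymbol_sum_quantRank {d : ℕ} (m : ℕ) (mu : ℝ) (S : Sym d) :
    prinSymbol m (∑ k ∈ Finset.range (m + 1), quantRank k mu S) = rankPart m S := by
  rw [map_sum, Finset.sum_range_succ, Finset.sum_eq_zero, zero_add, prinSymbol_quantRank le_rfl,
    if_pos rfl]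
  intro k hk
  have := Finset.mem_range.1 hk
  rw [prinSymbol_quantRank this.le, if_neg (by omega)]

/-- Each peeling step removes exactly the top remaining summand: those of lower rank have no part of
rank `n - i`, so the principal symbol found there is the rank-`(n - i)` part of `S`. -/
theorem remainder_quant {d n i : ℕ} (hi : i ≤ n + 1) (lam : ℝ) (S : Sym d) :
    remainder n lam i (quant n lam S) = ∑ k ∈ Finset.range (n + 1 - i), quantRank k lam S := by
  induction i with
  | zero => rw [quant_apply]; rfl
  | succ i ih =>
    have h : n + 1 - i = n - i + 1 := by omega
    rw [remainder, LinearMap.sub_apply, LinearMap.comp_apply, LinearMap.comp_apply, ih (by omega), h,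
      prinSymbol_sum_quantRank, quantRank_rankPart, if_pos rfl, Finset.sum_range_succ,
      add_sub_cancel_right, Nat.add_sub_add_right]

theorem component_quant {d n i : ℕ} (hi : i ≤ n) (lam : ℝ) (S : Sym d) :
    component n lam i (quant n lam S) = quantRank (n - i) lam S := by
  rw [component, LinearMap.comp_apply, LinearMap.comp_apply, remainder_quant (by omega),
    Nat.sub_add_comm hi, prinSymbol_sum_quantRank, quantRank_rankPart, if_pos rfl]

theorem quant_rankPart {d n k : ℕ} (hk : k ≤ n) (mu : ℝ) (S : Sym d) :
    quant n mu (rankPart k S) = quantRank k mu S := by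
  simp only [quant_apply, quantRank_rankPart, Finset.sum_ite_eq', Finset.mem_range]
  rw [if_pos (by omega)]

theorem fullSymbol_quant {d n : ℕ} (mu : ℝ) {S : Sym d} (hS : S.totalDegree ≤ n) :
    fullSymbol n mu (quant n mu S) = S := by
  conv_rhs => rw [← sum_rankPart hS, ← Finset.sum_range_reflect]
  rw [fullSymbol, LinearMap.sum_apply]
  refine Finset.sum_congr rfl fun i hi => ?_
  have hi' : i ≤ n := by have := Finset.mem_range.1 hi; omega
  rw [LinearMap.comp_apply, remainder_quant (by omega), Nat.sub_add_comm hi',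
    prinSymbol_sum_quantRank, Nat.add_sub_cancel]

theorem quantRank_mem {d : ℕ} (k : ℕ) (mu : ℝ) (S : Sym d) : quantRank k mu S ∈ diffOp d k := by
  rw [quantRank_apply, map_sum]
  refine sum_mem fun r hr => ?_
  have hr' : r ≤ k := by have := Finset.mem_range.1 hr; omega
  rw [map_smul]
  refine Submodule.smul_mem _ _ (diffOp_mono (Nat.sub_le k r) ?_)
  rw [show (divSym ^ r) (rankPart k S) = rankPart (k - r) ((divSym ^ r) S) by
    have := LinearMap.congr_fun (rankPart_divSym_pow (k - r) r) S
    rw [Nat.sub_add_cancel hr'] at this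
    exact this.symm]
  exact normalOrder_rankPart_mem _ _

theorem quant_mem {d : ℕ} (n : ℕ) (mu : ℝ) (S : Sym d) : quant n mu S ∈ diffOp d n := by
  rw [quant_apply]
  refine sum_mem fun k hk => diffOp_mono ?_ (quantRank_mem k mu S)
  have := Finset.mem_range.1 hk
  omega

/-- Triangular elimination. Subtracting `quantSym n mu S` kills the top rank `n`, the rest is
handled by induction, and the rank-`n` part of `S` is added to the solution. -/
theorem exists_sum_quantRank_eq {d : ℕ} (n : ℕ) (mu : ℝ) (S : Sym d)
    (hS : ∀ m, n ≤ m → rankPart m S = 0) :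
    ∃ T : Sym d, (∀ m, n ≤ m → rankPart m T = 0) ∧
      ∑ k ∈ Finset.range n, quantRank k mu T = normalOrder S := by
  induction n generalizing S with
  | zero =>
    have : S = 0 := by
      rw [← sum_rankPart (le_refl S.totalDegree)]
      exact Finset.sum_eq_zero fun m _ => hS m (Nat.zero_le m)
    exact ⟨0, fun m _ => map_zero _, by rw [this, map_zero, Finset.sum_range_zero]⟩
  | succ n ih =>
    obtain ⟨T, hT, e⟩ := ih (S - quantSym n mu S) fun m hm => by
      rw [map_sub, rankPart_quantSym hm]
      split_ifs with h
      · rw [h, sub_self]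
      · rw [hS m (by omega), sub_zero]
    refine ⟨T + rankPart n S, fun m hm => ?_, ?_⟩
    · rw [map_add, hT m (by omega), rankPart_rankPart, if_neg (by omega), add_zero]
    · have h1 : quantRank n mu T = 0 := by
        rw [quantRank_apply, hT n le_rfl]; simp
      rw [Finset.sum_range_succ, map_add, h1, zero_add, quantRank_rankPart, if_pos rfl]
      simp only [map_add, quantRank_rankPart, Finset.sum_add_distrib, Finset.sum_ite_eq',
        Finset.mem_range, lt_irrefl, if_false, add_zero, e, map_sub, quantRank_eq_normalOrder n,
        sub_add_cancel]

theorem exists_quant_eq {d n : ℕ} (mu : ℝ) {L : Op d} (hL : L ∈ diffOp d n) :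
    ∃ S : Sym d, S.totalDegree ≤ n ∧ quant n mu S = L := by
  obtain ⟨S, hS, rfl⟩ := exists_normalOrder_eq hL
  obtain ⟨T, hT, e⟩ := exists_sum_quantRank_eq (n + 1) mu S
    fun m hm => (totalDegree_le_iff_rankPart n S).1 hS m hm
  exact ⟨T, (totalDegree_le_iff_rankPart n T).2 fun m hm => hT m hm, by rw [quant_apply, e]⟩

theorem quant_fullSymbol {d n : ℕ} (mu : ℝ) {L : Op d} (hL : L ∈ diffOp d n) :
    quant n mu (fullSymbol n mu L) = L := by
  obtain ⟨S, hS, rfl⟩ := exists_quant_eq mu hL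
  rw [fullSymbol_quant mu hS]

theorem totalDegree_fullSymbol_le {d n : ℕ} (mu : ℝ) {L : Op d} (hL : L ∈ diffOp d n) :
    (fullSymbol n mu L).totalDegree ≤ n := by
  obtain ⟨S, hS, rfl⟩ := exists_quant_eq mu hL
  rwa [fullSymbol_quant mu hS]

theorem rankPart_lieSym {d : ℕ} (k : ℕ) (Y : VField d) (S : Sym d) :
    rankPart k (lieSym Y S) = lieSym Y (rankPart k S) := by
  rw [← lieSymHom_apply, ← lieSymHom_apply]
  exact LinearMap.congr_fun (rankPart_lieSymHom k Y) S

theorem totalDegree_lieSym_le {d n : ℕ} (Y : VField d) {S : Sym d} (hS : S.totalDegree ≤ n) :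
    (lieSym Y S).totalDegree ≤ n := by
  rw [totalDegree_le_iff_rankPart] at hS ⊢
  intro m hm
  rw [rankPart_lieSym, hS m hm, ← lieSymHom_apply, map_zero]

theorem adOp_quant {d : ℕ} (n : ℕ) (mu : ℝ) {Y : VField d} (hY : Y ∈ projFields d) (S : Sym d) :
    adOp mu Y (quant n mu S) = quant n mu (lieSym Y S) := by
  simp only [quant_apply, ← adOp_quantRank _ mu hY]
  simp only [adOp, Finset.mul_sum, Finset.sum_mul, Finset.sum_sub_distrib]

theorem fullSymbol_adOp {d n : ℕ} (mu : ℝ) {Y : VField d} (hY : Y ∈ projFields d) {L : Op d}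
    (hL : L ∈ diffOp d n) : fullSymbol n mu (adOp mu Y L) = lieSym Y (fullSymbol n mu L) := by
  obtain ⟨S, hS, rfl⟩ := exists_quant_eq mu hL
  rw [adOp_quant n mu hY, fullSymbol_quant mu hS, fullSymbol_quant mu (totalDegree_lieSym_le Y hS)]

/-- The full symbol map is an equivariant prolongation of the principal symbol. -/
theorem isProjFullSymbol_fullSymbol (d n : ℕ) (mu : ℝ) :
    IsProjFullSymbol d n mu (fullSymbol n mu ∘ₗ (diffOp d n).subtype) where
  degree_le L := totalDegree_fullSymbol_le mu L.2
  principal k hk L hL m hm := by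
    -- The operator is written as `Q_μ(S)` with `S` of rank `≤ k` rather than `≤ n`; the
    -- quantisations on ranks `≤ k` and `≤ n` agree on such `S`.
    obtain ⟨S, hS, e⟩ := exists_quant_eq mu hL
    have hS' := (totalDegree_le_iff_rankPart k S).1 hS
    have e' : quant n mu S = L.1 := by
      rw [← e, quant_apply, quant_apply]
      symm
      refine Finset.sum_subset (Finset.range_mono (by omega)) fun j _ hj => ?_
      rw [quantRank_apply, hS' j (by simpa using hj)]
      simp
    have h1 : fullSymbol n mu L.1 = S := by rw [← e', fullSymbol_quant mu (hS.trans hk)]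
    have h2 : prinSymbol k L.1 = rankPart k S := by
      rw [← e, quant_apply, prinSymbol_sum_quantRank]
    rw [LinearMap.comp_apply, Submodule.subtype_apply, h1, h2, ← rankPart_apply, map_sub,
      rankPart_rankPart]
    split_ifs with h
    · rw [h, sub_self]
    · rw [hS' m (by omega), sub_zero]
  equivariant Y hY L := fullSymbol_adOp mu hY L.2

/-! ### Hadamard's lemma -/

/-- Integrals of `C^n` functions depending on a parameter are `C^n`. -/
theorem contDiff_integral_of_contDiff {E : Type} [NormedAddCommGroup E] [NormedSpace ℝ E]
    [ProperSpace E] (n : ℕ) {F : Type} [NormedAddCommGroup F] [NormedSpace ℝ F] [CompleteSpace F]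
    {G : E × ℝ → F} (hG : ContDiff ℝ n G) : ContDiff ℝ n fun x => ∫ t in (0 : ℝ)..1, G (x, t) := by
  induction n generalizing F with
  | zero =>
    have hG' : Continuous G := hG.continuous
    rw [Nat.cast_zero, contDiff_zero]
    exact intervalIntegral.continuous_parametric_intervalIntegral_of_continuous'
      (f := fun x t => G (x, t)) hG' 0 1
  | succ n ih =>
    have hG1 : ContDiff ℝ n (fun p : E × ℝ => (fderiv ℝ G p).comp (ContinuousLinearMap.inl ℝ E ℝ)) :=
      (hG.fderiv_right (m := n) (by exact_mod_cast le_rfl)).clm_comp contDiff_const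
    have hc : Continuous fun p : E × ℝ => (fderiv ℝ G p).comp (ContinuousLinearMap.inl ℝ E ℝ) :=
      hG1.continuous
    have hG0 : Continuous G := hG.continuous
    -- The derivative is the integral of the partial derivative in `x`, to which the induction
    -- hypothesis applies with values in continuous linear maps; hence `F` is generalised.
    rw [Nat.cast_succ, contDiff_succ_iff_hasFDerivAt]
    refine ⟨_, ih hG1, fun x => ?_⟩
    -- A constant dominates the derivative on a closed ball times `[0, 1]`, compact because `E` is
    -- proper.
    obtain ⟨M, hM⟩ := ((isCompact_closedBall x 1).prod (isCompact_Icc (a := (0 : ℝ)) (b := 1))).exists_bound_of_continuousOn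
      hc.continuousOn
    refine intervalIntegral.hasFDerivAt_integral_of_dominated_of_fderiv_le
      (F := fun x t => G (x, t))
      (F' := fun x t => (fderiv ℝ G (x, t)).comp (ContinuousLinearMap.inl ℝ E ℝ))
      (bound := fun _ => M) (Metric.closedBall_mem_nhds x one_pos) ?_ ?_ ?_ ?_ ?_ ?_
    · exact Filter.Eventually.of_forall fun z =>
        (hG0.comp (by fun_prop : Continuous fun t : ℝ => (z, t))).aestronglyMeasurable
    · exact (hG0.comp (by fun_prop : Continuous fun t : ℝ => (x, t))).intervalIntegrable _ _
    · exact (hc.comp (by fun_prop : Continuous fun t : ℝ => (x, t))).aestronglyMeasurable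
    · refine Filter.Eventually.of_forall fun t ht z hz => hM (z, t) ⟨hz, ?_⟩
      rw [Set.uIoc_of_le zero_le_one] at ht
      exact Set.Ioc_subset_Icc_self ht
    · exact intervalIntegrable_const
    · refine Filter.Eventually.of_forall fun t _ z _ => ?_
      have h1 : HasFDerivAt G (fderiv ℝ G (z, t)) (z, t) :=
        (hG.differentiable (by simp) (z, t)).hasFDerivAt
      have h2 : HasFDerivAt (fun z : E => (z, t)) (ContinuousLinearMap.inl ℝ E ℝ) z :=
        hasFDerivAt_prodMk_left z t
      exact h1.comp z h2

/-- The mean of `f` over the segments issued from `x₀`. -/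
def segmentMean {d : ℕ} (x₀ : Fin d → ℝ) (f : Smooth d) : Smooth d :=
  ⟨fun x => ∫ t in (0 : ℝ)..1, f.1 (x₀ + t • (x - x₀)), by
    change ContDiff ℝ ∞ _
    rw [contDiff_infty]
    intro n
    refine contDiff_integral_of_contDiff n
      (G := fun p : (Fin d → ℝ) × ℝ => f.1 (x₀ + p.2 • (p.1 - x₀))) ?_
    have hf : ContDiff ℝ n f.1 := f.contDiff.of_le (by exact_mod_cast le_top)
    exact hf.comp (contDiff_const.add (contDiff_snd.smul (contDiff_fst.sub contDiff_const)))⟩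

theorem fderiv_apply_eq_sum {d : ℕ} (f : Smooth d) (x v : Fin d → ℝ) :
    fderiv ℝ f.1 x v = ∑ i, v i * (pd i f).1 x := by
  conv_lhs => rw [← Finset.univ_sum_single v, map_sum]
  refine Finset.sum_congr rfl fun i _ => ?_
  rw [show (Pi.single i (v i) : Fin d → ℝ) = v i • Pi.single i 1 by
    rw [← Pi.single_smul, smul_eq_mul, mul_one], map_smul]
  rfl

/-- The fundamental theorem of calculus on the segment from `x₀` to `x`. Functions vanishing at `x₀`
thus lie in the ideal generated by the centred coordinates, so the Schur lemma only has to treat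
multiplication by those. -/
theorem eq_add_sum_coordAt_mul {d : ℕ} (x₀ : Fin d → ℝ) (f : Smooth d) :
    f = algebraMap ℝ (Smooth d) (evalAt x₀ f)
      + ∑ i, coordAt x₀ i * segmentMean x₀ (pd i f) := by
  refine Smooth.ext fun x => ?_
  rw [← evalAt_apply, ← evalAt_apply]
  rw [map_add, AlgHom.commutes, map_sum]
  simp only [map_mul, coordAt, map_sub, AlgHom.commutes, Algebra.algebraMap_self, RingHom.id_apply]
  have hd : ∀ t : ℝ, HasDerivAt (fun t : ℝ => f.1 (x₀ + t • (x - x₀)))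
      (∑ i, (x i - x₀ i) * (pd i f).1 (x₀ + t • (x - x₀))) t := by
    intro t
    have h1 : HasDerivAt (fun t : ℝ => x₀ + t • (x - x₀)) (x - x₀) t := by
      simpa using ((hasDerivAt_id t).smul_const (x - x₀)).const_add x₀
    have h2 := (f.diffAt (x₀ + t • (x - x₀))).hasFDerivAt.comp_hasDerivAt t h1
    rw [fderiv_apply_eq_sum] at h2
    exact h2
  have hcont : ∀ i, Continuous fun t : ℝ => (x i - x₀ i) * (pd i f).1 (x₀ + t • (x - x₀)) := by
    intro i
    have : Continuous (pd i f).1 := (pd i f).contDiff.continuous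
    exact continuous_const.mul (this.comp (by fun_prop))
  have hi := intervalIntegral.integral_eq_sub_of_hasDerivAt (a := 0) (b := 1) (fun t _ => hd t)
    (Continuous.intervalIntegrable (continuous_finsetSum _ fun i _ => hcont i) _ _)
  rw [intervalIntegral.integral_finsetSum fun i _ => (hcont i).intervalIntegrable _ _] at hi
  simp only [intervalIntegral.integral_const_mul, one_smul, zero_smul, add_zero,
    add_sub_cancel] at hi
  exact eq_add_of_sub_eq' hi.symm

theorem eq_algebraMap_of_pd_eq_zero {d : ℕ} {f : Smooth d} (h : ∀ i, pd i f = 0) :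
    f = algebraMap ℝ (Smooth d) (evalAt 0 f) := by
  refine Smooth.ext fun x => ?_
  change f.1 x = f.1 0
  refine is_const_of_fderiv_eq_zero (f.contDiff.differentiable (by simp)) (fun z => ?_) x 0
  refine ContinuousLinearMap.ext fun v => ?_
  rw [fderiv_apply_eq_sum]
  refine Finset.sum_eq_zero fun i _ => ?_
  rw [h i]
  exact mul_zero _

/-! ### The projective algebra in translated coordinates -/

theorem single_one_mem_projFields {d : ℕ} (i : Fin d) : (Pi.single i 1 : VField d) ∈ projFields d :=
  Submodule.subset_span (Or.inl (Or.inl ⟨i, rfl⟩))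

theorem single_coordAt_mem_projFields {d : ℕ} (x₀ : Fin d → ℝ) (j i : Fin d) :
    (Pi.single i (coordAt x₀ j) : VField d) ∈ projFields d := by
  have h : (Pi.single i (coordAt x₀ j) : VField d)
      = (Pi.single i (coord j) : VField d) - x₀ j • (Pi.single i 1 : VField d) := by
    rw [← Pi.single_smul, ← Pi.single_sub, coordAt, Algebra.algebraMap_eq_smul_one]
  rw [h]
  exact sub_mem (Submodule.subset_span (Or.inl (Or.inr ⟨j, i, rfl⟩)))
    (Submodule.smul_mem _ _ (single_one_mem_projFields i))

/-- Expand `(x^k - c^k)(x^i - c^i) = x^k x^i - c^k (x^i - c^i) - c^i x^k`. Stability of the algebra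
under translations lets every point serve as the origin. -/
theorem special_coordAt_mem_projFields {d : ℕ} (x₀ : Fin d → ℝ) (k : Fin d) :
    (fun i => coordAt x₀ k * coordAt x₀ i : VField d) ∈ projFields d := by
  have h : (fun i => coordAt x₀ k * coordAt x₀ i : VField d)
      = (fun i => coord k * coord i) - x₀ k • ∑ i, (Pi.single i (coordAt x₀ i) : VField d)
        - ∑ i, x₀ i • (Pi.single i (coord k) : VField d) := by
    funext i
    simp only [Pi.sub_apply, Pi.smul_apply, Finset.sum_apply, Pi.single_apply, smul_ite, smul_zero,
      Finset.sum_ite_eq, Finset.mem_univ, if_true]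
    simp only [coordAt, Algebra.smul_def]
    ring
  rw [h]
  refine sub_mem (sub_mem (Submodule.subset_span (Or.inr ⟨k, rfl⟩)) ?_) ?_
  · exact Submodule.smul_mem _ _ (sum_mem fun i _ => single_coordAt_mem_projFields x₀ i i)
  · exact sum_mem fun i _ => Submodule.smul_mem _ _
      (Submodule.subset_span (Or.inl (Or.inr ⟨k, i, rfl⟩)))

/-! ### Equivariant endomorphisms of the space of symbols -/

/-- Equivariance of a linear endomorphism of the space of symbols. -/
def IsProjEquivariant {d : ℕ} (T : Module.End ℝ (Sym d)) : Prop :=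
  ∀ Y ∈ projFields d, ∀ S, T (lieSym Y S) = lieSym Y (T S)

/-- The value at `x₀` of the coefficient of `ξ^α`. -/
def coeffAt {d : ℕ} (x₀ : Fin d → ℝ) (α : Fin d →₀ ℕ) : Sym d →ₗ[ℝ] ℝ :=
  (evalAt x₀).toLinearMap ∘ₗ (MvPolynomial.lcoeff (Smooth d) α).restrictScalars ℝ

theorem coeffAt_apply {d : ℕ} (x₀ : Fin d → ℝ) (α : Fin d →₀ ℕ) (S : Sym d) :
    coeffAt x₀ α S = evalAt x₀ (S.coeff α) := rfl

theorem coeffAt_mulSym {d : ℕ} (x₀ : Fin d → ℝ) (α : Fin d →₀ ℕ) (f : Smooth d) (S : Sym d) :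
    coeffAt x₀ α (mulSym f S) = evalAt x₀ f * coeffAt x₀ α S := by
  rw [coeffAt_apply, mulSym_apply, MvPolynomial.coeff_C_mul, map_mul, coeffAt_apply]

theorem coeffAt_xiEuler {d : ℕ} (x₀ : Fin d → ℝ) (α : Fin d →₀ ℕ) (S : Sym d) :
    coeffAt x₀ α (xiEuler d S) = α.degree * coeffAt x₀ α S := by
  rw [coeffAt_apply, coeff_xiEuler, map_smul, smul_eq_mul, coeffAt_apply]

theorem coeffAt_baseEuler {d : ℕ} (x₀ : Fin d → ℝ) (α : Fin d →₀ ℕ) (S : Sym d) :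
    coeffAt x₀ α (baseEuler (coordAt x₀) S) = 0 := by
  simp only [baseEuler, LinearMap.sum_apply, Module.End.mul_apply, map_sum, coeffAt_mulSym,
    evalAt_coordAt, zero_mul, Finset.sum_const_zero]

/-- A special field vanishes to second order at its centre, so its Lie derivative has no value
there. -/
theorem coeffAt_lieSpecial {d : ℕ} (x₀ : Fin d → ℝ) (α : Fin d →₀ ℕ) (k : Fin d) (S : Sym d) :
    coeffAt x₀ α (lieSpecial (coordAt x₀) k S) = 0 := by
  simp only [lieSpecial, pairMul, LinearMap.sub_apply, LinearMap.sum_apply, Module.End.mul_apply,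
    map_sub, map_sum, coeffAt_mulSym, evalAt_coordAt, zero_mul, Finset.sum_const_zero, sub_zero]

section Equivariant

variable {d : ℕ} {T : Module.End ℝ (Sym d)} (hT : IsProjEquivariant T)
include hT

theorem IsProjEquivariant.apply_lieSymHom {Y : VField d} (hY : Y ∈ projFields d) (S : Sym d) :
    T (lieSymHom d Y S) = lieSymHom d Y (T S) := by
  rw [lieSymHom_apply, lieSymHom_apply, hT Y hY]

/-- The Lie derivative along `∑ y^i ∂_i` is `baseEuler - xiEuler`. At `x₀`, only the rank survives
of its action on `T S`. -/
theorem IsProjEquivariant.coeffAt_baseEuler (x₀ : Fin d → ℝ) (α : Fin d →₀ ℕ) {k : ℝ} {S : Sym d}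
    (hS : xiEuler d S = k • S) :
    coeffAt x₀ α (T (baseEuler (coordAt x₀) S)) = (k - α.degree) * coeffAt x₀ α (T S) := by
  have h : lieSymHom d (∑ i, Pi.single i (coordAt x₀ i)) = baseEuler (coordAt x₀) - xiEuler d := by
    rw [map_sum]
    simp only [lieSymHom_linear (pd_coordAt x₀), Finset.sum_sub_distrib, baseEuler, xiEuler]
  have h1 := congrArg (coeffAt x₀ α) (hT.apply_lieSymHom
    (sum_mem fun i (_ : i ∈ Finset.univ) => single_coordAt_mem_projFields x₀ i i) S)
  rw [h, LinearMap.sub_apply, LinearMap.sub_apply, map_sub, map_sub, map_sub, hS, map_smul,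
    map_smul, ProjPencil.coeffAt_baseEuler, coeffAt_xiEuler, smul_eq_mul] at h1
  linarith

/-- Equivariance under the special field gives zero at `x₀`. The term `T(y^j ∑ y^i ∂_i S)` in it is
removed by applying the Euler relation to `y^j S`. -/
theorem IsProjEquivariant.coeffAt_special (x₀ : Fin d → ℝ) (α : Fin d →₀ ℕ) (j : Fin d) {k : ℝ}
    {S : Sym d} (hS : xiEuler d S = k • S) :
    (α.degree + 1) * coeffAt x₀ α (T (mulSym (coordAt x₀ j) S))
      + coeffAt x₀ α (T (pairMul (coordAt x₀) (xiPd j S))) = 0 := by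
  have h1 := congrArg (coeffAt x₀ α)
    (hT.apply_lieSymHom (special_coordAt_mem_projFields x₀ j) S)
  have h2 := LinearMap.congr_fun (baseEuler_mul_coord (pd_coordAt x₀) j) S
  have h3 : xiEuler d (mulSym (coordAt x₀ j) S) = k • mulSym (coordAt x₀ j) S := by
    rw [← map_smul, ← hS]
    exact LinearMap.congr_fun (xiEuler_mulSym (coordAt x₀ j)) S
  have h4 := hT.coeffAt_baseEuler x₀ α h3
  rw [Module.End.mul_apply] at h2
  rw [h2] at h4
  rw [lieSymHom_special (pd_coordAt x₀), coeffAt_lieSpecial] at h1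
  simp only [lieSpecial, LinearMap.sub_apply, LinearMap.add_apply, Module.End.mul_apply, hS,
    map_sub, map_add, map_smul, smul_eq_mul] at h1 h4
  linarith

theorem IsProjEquivariant.coeffAt_mulSym_coordAt (x₀ : Fin d → ℝ) (α : Fin d →₀ ℕ) (j : Fin d)
    {k : ℝ} (hk : 0 ≤ k) {S : Sym d} (hS : xiEuler d S = k • S) :
    coeffAt x₀ α (T (mulSym (coordAt x₀ j) S)) = 0 := by
  have hd : (0 : ℝ) < d := by exact_mod_cast j.pos
  have h0 : (0 : ℝ) ≤ α.degree := Nat.cast_nonneg _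
  have hG : ∀ R, xiEuler d R = (k - 1) • R → coeffAt x₀ α (T (pairMul (coordAt x₀) R)) = 0 := by
    intro R hR
    have hmul : ∀ i, xiEuler d (xiMul i R) = k • xiMul i R := by
      intro i
      have : xiEuler d * xiMul i = xiMul i * xiEuler d + xiMul i := by
        simp only [xiEuler, Finset.mul_sum, Finset.sum_mul, mul_assoc, xiPd_xiMul, mul_add,
          Finset.sum_add_distrib, mul_ite, mul_one, mul_zero, Finset.sum_ite_eq', Finset.mem_univ,
          if_true]
        simp only [← mul_assoc, xiMul_comm i]
      have h := LinearMap.congr_fun this R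
      rw [Module.End.mul_apply, LinearMap.add_apply, Module.End.mul_apply, hR, map_smul] at h
      rw [h]; module
    have hsum : ∑ i, xiPd i (xiMul i R) = (k - 1 + d) • R := by
      have : ∀ i, xiPd i (xiMul i R) = xiMul i (xiPd i R) + R := fun i => by
        have := LinearMap.congr_fun (xiPd_xiMul i i) R
        rwa [if_pos rfl] at this
      simp only [this, Finset.sum_add_distrib, Finset.sum_const, Finset.card_univ, Fintype.card_fin,
        add_smul, Nat.cast_smul_eq_nsmul]
      rw [← hR]
      simp only [xiEuler, LinearMap.sum_apply, Module.End.mul_apply]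
    -- Taking `S = ξ_i R` in `coeffAt_special` and summing over `i` turns both terms into multiples
    -- of one quantity. The total factor is `|α| + 1 + (k - 1 + d) = |α| + k + d`, which is
    -- positive.
    have h1 := Finset.sum_eq_zero fun i (_ : i ∈ Finset.univ) =>
      hT.coeffAt_special x₀ α i (hmul i)
    rw [Finset.sum_add_distrib, ← Finset.mul_sum, ← map_sum, ← map_sum, ← map_sum, ← map_sum,
      ← map_sum, hsum, map_smul, map_smul, map_smul, smul_eq_mul] at h1
    have h2 : ∑ i, mulSym (coordAt x₀ i) (xiMul i R) = pairMul (coordAt x₀) R := by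
      simp only [pairMul, LinearMap.sum_apply, Module.End.mul_apply]
    rw [h2, ← add_mul] at h1
    exact (mul_eq_zero.1 h1).resolve_left (ne_of_gt (by linarith))
  have h := hT.coeffAt_special x₀ α j hS
  rw [hG _ (xiEuler_xiPd hS j), add_zero] at h
  exact (mul_eq_zero.1 h).resolve_left (by positivity)

/-- Hadamard's lemma splits `a` into its value at `x₀` and multiples of centred coordinates, which
`T` sends to symbols vanishing at `x₀`. So `T` is tensorial. -/
theorem IsProjEquivariant.coeffAt_monomial_mul (x₀ : Fin d → ℝ) (α β : Fin d →₀ ℕ) (a : Smooth d) :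
    coeffAt x₀ α (T (monomial β a)) = evalAt x₀ a * coeffAt x₀ α (T (monomial β 1)) := by
  have h : ∀ i b, coeffAt x₀ α (T (monomial β (coordAt x₀ i * b))) = 0 := by
    intro i b
    have hb : xiEuler d (monomial β b) = (β.degree : ℝ) • monomial β b := by
      have := xiEuler_rankPart β.degree (monomial β b)
      rwa [rankPart_monomial, if_pos rfl] at this
    rw [← MvPolynomial.C_mul_monomial, ← mulSym_apply]
    exact hT.coeffAt_mulSym_coordAt x₀ α i (Nat.cast_nonneg _) hb
  conv_lhs => rw [eq_add_sum_coordAt_mul x₀ a]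
  rw [map_add, map_sum, map_add, map_sum, map_add, map_sum, Finset.sum_eq_zero fun i _ => h i _,
    add_zero, Algebra.algebraMap_eq_smul_one, ← MvPolynomial.smul_monomial, map_smul, map_smul,
    smul_eq_mul]

theorem IsProjEquivariant.coeffPd_apply_monomial (i : Fin d) (β : Fin d →₀ ℕ) :
    coeffPd i (T (monomial β 1)) = 0 := by
  rw [← lieSymHom_single_one, ← hT.apply_lieSymHom (single_one_mem_projFields i),
    lieSymHom_single_one, coeffPd_monomial, pd_one, map_zero, map_zero]

/-- On symbols with constant coefficients, a linear field acts only through `-ξ_i ∂/∂ξ_j`. -/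
theorem IsProjEquivariant.apply_xiMul_xiPd (i j : Fin d) (β : Fin d →₀ ℕ) :
    T (xiMul i (xiPd j (monomial β 1))) = xiMul i (xiPd j (T (monomial β 1))) := by
  have h := hT.apply_lieSymHom (single_coordAt_mem_projFields 0 j i) (monomial β 1)
  rw [lieSymHom_linear (pd_coordAt 0), LinearMap.sub_apply, LinearMap.sub_apply,
    Module.End.mul_apply, Module.End.mul_apply, Module.End.mul_apply, Module.End.mul_apply,
    hT.coeffPd_apply_monomial, coeffPd_monomial, pd_one, map_zero, map_zero, zero_sub,
    zero_sub, map_neg, neg_inj] at h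
  exact h

theorem IsProjEquivariant.exists_monomial : ∃ c : (Fin d →₀ ℕ) → ℝ,
    ∀ β a, T (monomial β a) = c β • monomial β a := by
  refine ⟨fun β => evalAt 0 ((T (monomial β 1)).coeff β), fun β a => ?_⟩
  ext α : 1
  have hconst : (T (monomial β 1)).coeff α
      = algebraMap ℝ (Smooth d) (evalAt 0 ((T (monomial β 1)).coeff α)) :=
    eq_algebraMap_of_pd_eq_zero fun i => by
      rw [← coeff_coeffPd, hT.coeffPd_apply_monomial, MvPolynomial.coeff_zero]
  have ha : (T (monomial β a)).coeff α = (evalAt 0 ((T (monomial β 1)).coeff α)) • a := by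
    refine Smooth.ext fun x => ?_
    have h := hT.coeffAt_monomial_mul x α β a
    rw [coeffAt_apply, coeffAt_apply, hconst, AlgHom.commutes] at h
    rw [← evalAt_apply, h, ← evalAt_apply, map_smul, smul_eq_mul, mul_comm]
    rfl
  rw [ha, MvPolynomial.coeff_smul, MvPolynomial.coeff_monomial]
  by_cases hαβ : β = α
  · subst hαβ; rw [if_pos rfl]
  · obtain ⟨i, hi⟩ : ∃ i, β i ≠ α i := by
      by_contra hc
      push Not at hc
      exact hαβ (Finsupp.ext hc)
    -- Commutation with `ξ_i ∂/∂ξ_i` excludes monomials whose `i`-th exponent differs from that of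
    -- `β`.
    have h := congrArg (MvPolynomial.coeff α) (hT.apply_xiMul_xiPd i i β)
    have hβ : xiMul i (xiPd i (monomial β (1 : Smooth d))) = (β i : ℝ) • monomial β 1 := by
      rw [xiMul_apply, xiPd_apply, MvPolynomial.X_mul_pderiv_monomial, Nat.cast_smul_eq_nsmul]
    rw [hβ, map_smul, MvPolynomial.coeff_smul, coeff_xiMul_xiPd, ← sub_eq_zero, ← sub_smul] at h
    have h0 : (T (monomial β 1)).coeff α = 0 :=
      (smul_eq_zero.1 h).resolve_left (sub_ne_zero.2 (by exact_mod_cast hi))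
    rw [h0, map_zero, zero_smul, if_neg hαβ, smul_zero]

/-- A `proj`-equivariant endomorphism of the space of symbols is a scalar on each rank. -/
theorem IsProjEquivariant.exists_scalar (hd : 0 < d) : ∃ c : ℕ → ℝ,
    ∀ k S, T (rankPart k S) = c k • rankPart k S := by
  obtain ⟨c, hc⟩ := hT.exists_monomial
  -- `ξ_i ∂/∂ξ_j` carries one monomial to a multiple `β j + 1` of the other, nonzero in
  -- characteristic zero.
  have hstep : ∀ (i j : Fin d) (β : Fin d →₀ ℕ),
      c (β + Finsupp.single j 1) = c (β + Finsupp.single i 1) := by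
    intro i j β
    have hβ : xiMul i (xiPd j (monomial (β + Finsupp.single j 1) (1 : Smooth d)))
        = monomial (β + Finsupp.single i 1) ((β j + 1 : ℕ) : Smooth d) := by
      rw [xiMul_apply, xiPd_apply, MvPolynomial.pderiv_monomial, add_tsub_cancel_right,
        MvPolynomial.X, MvPolynomial.monomial_mul, add_comm (Finsupp.single i 1), one_mul, one_mul,
        Finsupp.add_apply, Finsupp.single_eq_same]
    have h := hT.apply_xiMul_xiPd i j (β + Finsupp.single j 1)
    rw [hβ, hc, hc, map_smul, map_smul, hβ] at h
    have h' := congrArg (coeffAt 0 (β + Finsupp.single i 1)) h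
    rw [map_smul, map_smul, coeffAt_apply, MvPolynomial.coeff_monomial, if_pos rfl, map_natCast,
      smul_eq_mul, smul_eq_mul] at h'
    exact (mul_right_cancel₀ (by positivity) h').symm
  let o : Fin d := ⟨0, hd⟩
  -- All momenta are exchanged for the single `ξ_o`, so the scalar depends only on the degree. The
  -- spare `γ` makes the induction on `β` work.
  have hmove : ∀ (β γ : Fin d →₀ ℕ), c (γ + β) = c (γ + Finsupp.single o β.degree) := by
    intro β
    induction β using Finsupp.induction_linear with
    | zero => intro γ; simp
    | add β₁ β₂ h₁ h₂ =>
      intro γ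
      rw [← add_assoc, h₂, add_right_comm, h₁, map_add, Finsupp.single_add, add_right_comm, add_assoc]
    | single j m =>
      intro γ
      rw [Finsupp.degree_single]
      induction m generalizing γ with
      | zero => simp
      | succ m ih =>
        rw [Finsupp.single_add, ← add_assoc, hstep o j, add_right_comm, ih, Finsupp.single_add,
          add_right_comm, add_assoc]
  refine ⟨fun k => c (Finsupp.single o k), fun k S => ?_⟩
  refine LinearMap.congr_fun (f := T * rankPart k) (g := c (Finsupp.single o k) • rankPart k)
    (sym_hom_ext fun α a => ?_) S
  rw [Module.End.mul_apply, LinearMap.smul_apply, rankPart_monomial]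
  split_ifs with h
  · have := hmove α 0
    rw [zero_add, zero_add, h] at this
    rw [hc, this]
  · rw [map_zero, smul_zero]

end Equivariant

/-! ### Uniqueness of the full symbol map -/

/-- The quantisation with values in the space of differential operators. -/
def quantDiff {d : ℕ} (n : ℕ) (mu : ℝ) : Sym d →ₗ[ℝ] diffOp d n :=
  (quant n mu).codRestrict _ (quant_mem n mu)

theorem coe_quantDiff {d : ℕ} (n : ℕ) (mu : ℝ) (S : Sym d) :
    (quantDiff n mu S : Op d) = quant n mu S := rfl

theorem adDiff_quantDiff {d : ℕ} (n : ℕ) (mu : ℝ) {Y : VField d} (hY : Y ∈ projFields d)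
    (S : Sym d) : adDiff mu Y (quantDiff n mu S) = quantDiff n mu (lieSym Y S) :=
  Subtype.ext (adOp_quant n mu hY S)

theorem exists_quantDiff_eq {d n : ℕ} (mu : ℝ) (L : diffOp d n) :
    ∃ S : Sym d, S.totalDegree ≤ n ∧ quantDiff n mu S = L := by
  obtain ⟨S, hS, e⟩ := exists_quant_eq mu L.2
  exact ⟨S, hS, Subtype.ext e⟩

theorem linearMap_ext_quantDiff {d n : ℕ} (mu : ℝ) {V : Type*} [AddCommGroup V] [Module ℝ V]
    {f g : diffOp d n →ₗ[ℝ] V}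
    (h : ∀ k ≤ n, ∀ S, f (quantDiff n mu (rankPart k S)) = g (quantDiff n mu (rankPart k S))) :
    f = g := by
  refine LinearMap.ext fun L => ?_
  obtain ⟨S, hS, rfl⟩ := exists_quantDiff_eq mu L
  rw [← sum_rankPart hS]
  simp only [map_sum]
  refine Finset.sum_congr rfl fun k hk => h k ?_ S
  have := Finset.mem_range.1 hk
  omega

theorem rankPart_ne_zero {d : ℕ} (hd : 0 < d) (k : ℕ) :
    rankPart k (monomial (Finsupp.single (⟨0, hd⟩ : Fin d) k) (1 : Smooth d)) ≠ 0 := by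
  rw [rankPart_monomial, Finsupp.degree_single, if_pos rfl]
  intro h
  have := congrArg (coeffAt 0 (Finsupp.single ⟨0, hd⟩ k)) h
  rw [coeffAt_apply, MvPolynomial.coeff_monomial, if_pos rfl, map_one, map_zero] at this
  exact one_ne_zero this

/-- By the Schur lemma `σ ∘ Q_μ` is a scalar on each rank; comparing principal symbols on one
nonzero symbol of that rank shows that the scalar is `1`. -/
theorem isProjFullSymbol_iff {d n : ℕ} (hd : 0 < d) (mu : ℝ) (σ : diffOp d n →ₗ[ℝ] Sym d) :
    IsProjFullSymbol d n mu σ ↔ σ = fullSymbol n mu ∘ₗ (diffOp d n).subtype := by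
  refine ⟨fun hσ => ?_, fun h => h ▸ isProjFullSymbol_fullSymbol d n mu⟩
  have hT : IsProjEquivariant (σ ∘ₗ quantDiff n mu) := fun Y hY S => by
    rw [LinearMap.comp_apply, LinearMap.comp_apply, ← adDiff_quantDiff n mu hY,
      hσ.equivariant Y hY]
  obtain ⟨c, hc⟩ := hT.exists_scalar hd
  refine linearMap_ext_quantDiff mu fun k hk S => ?_
  have hc1 : c k = 1 := by
    by_contra hne
    refine rankPart_ne_zero hd k ?_
    generalize (monomial (Finsupp.single (⟨0, hd⟩ : Fin d) k) (1 : Smooth d)) = R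
    have hmem : (quantDiff n mu (rankPart k R) : Op d) = quantRank k mu R := quant_rankPart hk mu R
    have h := hσ.principal k hk (quantDiff n mu (rankPart k R))
      (hmem ▸ quantRank_mem k mu R) k le_rfl
    have h1 : σ (quantDiff n mu (rankPart k R)) = c k • rankPart k R := hc k R
    rw [h1, hmem, prinSymbol_quantRank le_rfl, if_pos rfl, ← rankPart_apply, map_sub, map_smul,
      rankPart_rankPart, if_pos rfl] at h
    have h2 : (c k - 1) • rankPart k R = 0 := by rw [sub_smul, one_smul]; exact h
    exact (smul_eq_zero.1 h2).resolve_left (sub_ne_zero.2 hne)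
  have h1 : σ (quantDiff n mu (rankPart k S)) = c k • rankPart k S := hc k S
  rw [h1, hc1, one_smul, LinearMap.comp_apply, Submodule.subtype_apply, coe_quantDiff,
    fullSymbol_quant mu ((totalDegree_rankPart_le k S).trans hk)]

/-! ### The dressed liftings -/

/-- `Q_λ` of a symbol of rank `k` is its own component of index `n - k` and has no other, so
dressing is diagonal. All later statements on `dressed` are read off from this formula. -/
theorem dressed_quantDiff {d n k : ℕ} (hk : k ≤ n) (lam : ℝ)
    (a : Matrix (Fin (n + 1)) (Fin (n + 1)) ℝ) (mu : ℝ) (S : Sym d) :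
    dressed d lam a (quantDiff n lam (rankPart k S)) mu
      = (rowPoly a ⟨n - k, by omega⟩ mu / rowPoly a ⟨n - k, by omega⟩ lam) • quantRank k mu S := by
  have h : ∀ i : Fin (n + 1),
      dlo n lam mu (component n lam i (quant n lam (rankPart k S)))
        = if i = ⟨n - k, by omega⟩ then quantRank k mu S else 0 := by
    intro i
    have hi : (i : ℕ) ≤ n := by omega
    rw [component_quant hi, ← quant_rankPart (Nat.sub_le n i), dlo, LinearMap.comp_apply,
      fullSymbol_quant lam ((totalDegree_rankPart_le _ _).trans (Nat.sub_le n i)),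
      quant_rankPart (Nat.sub_le n i), quantRank_rankPart]
    have : n - (i : ℕ) = k ↔ i = ⟨n - k, by omega⟩ := by
      rw [Fin.ext_iff]; simp only; omega
    by_cases h : n - (i : ℕ) = k
    · rw [if_pos h, if_pos (this.1 h), h]
    · rw [if_neg h, if_neg fun h' => h (this.2 h')]
  rw [dressed, LinearMap.pi_apply, LinearMap.comp_apply, LinearMap.sum_apply,
    Submodule.subtype_apply, coe_quantDiff]
  simp only [LinearMap.smul_apply, LinearMap.comp_apply, h, smul_ite, smul_zero,
    Finset.sum_ite_eq', Finset.mem_univ, if_true]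

theorem pow_smul_mem_pencilOp {d n j k : ℕ} (h : j + k ≤ n) {L : Op d} (hL : L ∈ diffOp d k) :
    (fun mu => mu ^ j • L : Pencil d) ∈ pencilOp d n :=
  Submodule.subset_span ⟨j, k, h, L, hL, rfl⟩

/-- Multiplication of pencils by polynomials in the weight. -/
theorem eval_smul_mem_pencilOp {d n m k : ℕ} (h : m + k ≤ n) {p : Polynomial ℝ}
    (hp : p.natDegree ≤ m) {L : Op d} (hL : L ∈ diffOp d k) :
    (fun mu => p.eval mu • L : Pencil d) ∈ pencilOp d n := by
  have e : (fun mu => p.eval mu • L : Pencil d)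
      = ∑ j ∈ Finset.range (m + 1), p.coeff j • (fun mu => mu ^ j • L : Pencil d) := by
    funext mu
    rw [Finset.sum_apply, Polynomial.eval_eq_sum_range' (Nat.lt_succ_of_le hp), Finset.sum_smul]
    exact Finset.sum_congr rfl fun j _ => mul_smul _ _ _
  rw [e]
  refine sum_mem fun j hj => Submodule.smul_mem _ _ (pow_smul_mem_pencilOp ?_ hL)
  have := Finset.mem_range.1 hj
  omega

/-- Degree `r` in the weight is exactly paid for by the order lost to `r` divergences; this makes
the DLO pencil regular. -/
theorem exists_polynomial_quantCoeff (d k r : ℕ) :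
    ∃ p : Polynomial ℝ, p.natDegree ≤ r ∧ ∀ mu, p.eval mu = quantCoeff d k r mu := by
  let q : ℕ → Polynomial ℝ := fun j =>
    Polynomial.C (((d : ℝ) + 2 * k - j)⁻¹) *
      (Polynomial.C (d + 1 : ℝ) * Polynomial.X + Polynomial.C ((k : ℝ) - j))
  have hq : ∀ j, (q j).natDegree ≤ 1 := fun j =>
    (Polynomial.natDegree_C_mul_le _ _).trans Polynomial.natDegree_linear_le
  refine ⟨Polynomial.C (1 / (r.factorial : ℝ)) * ∏ j ∈ Finset.Icc 1 r, q j, ?_, fun mu => ?_⟩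
  · refine (Polynomial.natDegree_C_mul_le _ _).trans ((Polynomial.natDegree_prod_le _ _).trans ?_)
    refine (Finset.sum_le_card_nsmul _ _ 1 fun j _ => hq j).trans ?_
    simp
  · rw [quantCoeff, Polynomial.eval_mul, Polynomial.eval_C, Polynomial.eval_prod]
    congr 1
    refine Finset.prod_congr rfl fun j _ => ?_
    simp only [q, Polynomial.eval_mul, Polynomial.eval_add, Polynomial.eval_C, Polynomial.eval_X]
    rw [div_eq_inv_mul]
    ring

theorem divSym_pow_rankPart_mem {d k r : ℕ} (hr : r ≤ k) (S : Sym d) :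
    normalOrder ((divSym ^ r) (rankPart k S)) ∈ diffOp d (k - r) := by
  have := LinearMap.congr_fun (rankPart_divSym_pow (k - r) r) S
  rw [Nat.sub_add_cancel hr, Module.End.mul_apply, Module.End.mul_apply] at this
  rw [← this]
  exact normalOrder_rankPart_mem _ _

/-- The `r`-th term has degree at most `m + r` in the weight and order at most `k - r`, hence total
order at most `m + k`. -/
theorem eval_smul_quantRank_mem_pencilOp {d n m k : ℕ} (h : m + k ≤ n) {p : Polynomial ℝ}
    (hp : p.natDegree ≤ m) (S : Sym d) :
    (fun mu => p.eval mu • quantRank k mu S : Pencil d) ∈ pencilOp d n := by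
  choose q hq hq' using fun r => exists_polynomial_quantCoeff d k r
  have e : (fun mu => p.eval mu • quantRank k mu S : Pencil d)
      = ∑ r ∈ Finset.range (k + 1),
        (fun mu => (p * q r).eval mu • normalOrder ((divSym ^ r) (rankPart k S)) : Pencil d) := by
    funext mu
    rw [Finset.sum_apply, quantRank_apply, map_sum, Finset.smul_sum]
    refine Finset.sum_congr rfl fun r _ => ?_
    rw [map_smul, smul_smul, Polynomial.eval_mul, hq']
  rw [e]
  refine sum_mem fun r hr => ?_
  have hr' : r ≤ k := by have := Finset.mem_range.1 hr; omega
  exact eval_smul_mem_pencilOp (m := m + r) (by omega)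
    (Polynomial.natDegree_mul_le.trans (add_le_add hp (hq r))) (divSym_pow_rankPart_mem hr' S)

/-- The row polynomials as polynomials. -/
def rowPolynomial {n : ℕ} (a : Matrix (Fin (n + 1)) (Fin (n + 1)) ℝ) (i : Fin (n + 1)) :
    Polynomial ℝ :=
  ∑ j : Fin (n + 1), Polynomial.monomial (j : ℕ) (a i j)

theorem eval_rowPolynomial {n : ℕ} (a : Matrix (Fin (n + 1)) (Fin (n + 1)) ℝ) (i : Fin (n + 1))
    (mu : ℝ) : (rowPolynomial a i).eval mu = rowPoly a i mu := by
  simp only [rowPolynomial, rowPoly, Polynomial.eval_finsetSum, Polynomial.eval_monomial]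

theorem natDegree_rowPolynomial_le {n : ℕ} {lam : ℝ} {a : Matrix (Fin (n + 1)) (Fin (n + 1)) ℝ}
    (ha : IsAdmissible lam a) (i : Fin (n + 1)) : (rowPolynomial a i).natDegree ≤ i := by
  refine Polynomial.natDegree_sum_le_of_forall_le _ _ fun j _ => ?_
  by_cases h : i < j
  · rw [ha.lower i j h, map_zero]; simp
  · exact (Polynomial.natDegree_monomial_le _).trans (not_lt.1 h)

theorem quantDiff_eq_sum {d n : ℕ} (mu : ℝ) {S : Sym d} (hS : S.totalDegree ≤ n) :
    quantDiff n mu S = ∑ k ∈ Finset.range (n + 1), quantDiff n mu (rankPart k S) := by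
  conv_lhs => rw [← sum_rankPart hS, map_sum]

theorem isRegularProjLifting_dressed (d : ℕ) {n : ℕ} {lam : ℝ}
    {a : Matrix (Fin (n + 1)) (Fin (n + 1)) ℝ} (ha : IsAdmissible lam a) :
    IsRegularProjLifting d n lam (dressed d lam a) where
  passes L := by
    have : LinearMap.proj lam ∘ₗ dressed d lam a = (diffOp d n).subtype := by
      refine linearMap_ext_quantDiff lam fun k hk S => ?_
      rw [LinearMap.comp_apply, LinearMap.proj_apply, dressed_quantDiff hk, div_self (ha.denom_ne _),
        one_smul, Submodule.subtype_apply, coe_quantDiff, quant_rankPart hk]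
    exact LinearMap.congr_fun this L
  regular L := by
    obtain ⟨S, hS, rfl⟩ := exists_quantDiff_eq lam L
    rw [quantDiff_eq_sum lam hS, map_sum]
    refine sum_mem fun k hk => ?_
    have hk' : k ≤ n := by have := Finset.mem_range.1 hk; omega
    have e : dressed d lam a (quantDiff n lam (rankPart k S))
        = (rowPoly a ⟨n - k, by omega⟩ lam)⁻¹ •
          fun mu => (rowPolynomial a ⟨n - k, by omega⟩).eval mu • quantRank k mu S := by
      funext mu
      rw [dressed_quantDiff hk', Pi.smul_apply, smul_smul, eval_rowPolynomial, div_eq_inv_mul]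
    rw [e]
    refine Submodule.smul_mem _ _ (eval_smul_quantRank_mem_pencilOp (m := n - k) (by omega) ?_ S)
    exact natDegree_rowPolynomial_le ha _
  equivariant Y hY L := by
    obtain ⟨S, hS, rfl⟩ := exists_quantDiff_eq lam L
    rw [adDiff_quantDiff n lam hY, quantDiff_eq_sum lam hS,
      quantDiff_eq_sum lam (totalDegree_lieSym_le Y hS), map_sum, map_sum]
    funext mu
    rw [Finset.sum_apply, adPencil, ← adHom_apply, Finset.sum_apply]
    have hsum : ∀ (f : ℕ → Op d) (s : Finset ℕ),
        adHom mu (∑ k ∈ s, f k) Y = ∑ k ∈ s, adHom mu (f k) Y := by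
      intro f s
      simp only [adHom_apply, adOp, Finset.mul_sum, Finset.sum_mul, Finset.sum_sub_distrib]
    rw [hsum]
    refine Finset.sum_congr rfl fun k hk => ?_
    have hk' : k ≤ n := by have := Finset.mem_range.1 hk; omega
    have hsmul : ∀ (c : ℝ) (M : Op d), adHom mu (c • M) Y = c • adOp mu Y M := by
      intro c M
      simp only [adHom_apply, adOp, mul_smul_comm, smul_mul_assoc, smul_sub]
    rw [dressed_quantDiff hk', dressed_quantDiff hk', hsmul, adOp_quantRank k mu hY]

/-! ### Every regular equivariant lifting is dressed -/

/-- For each fixed `μ`, the Schur lemma applies to `S ↦ σ_μ(F(Q_λ S)|_μ)`. -/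
theorem exists_quantRank_of_lifting {d n : ℕ} (hd : 0 < d) {lam : ℝ} {F : LiftMap d n}
    (hF : IsRegularProjLifting d n lam F) (hF' : ∀ L mu, F L mu ∈ diffOp d n) :
    ∃ c : ℕ → ℝ → ℝ, ∀ k ≤ n, ∀ S mu,
      F (quantDiff n lam (rankPart k S)) mu = c k mu • quantRank k mu S := by
  have h : ∀ mu, ∃ c : ℕ → ℝ, ∀ k S,
      fullSymbol n mu (F (quantDiff n lam (rankPart k S)) mu) = c k • rankPart k S := by
    intro mu
    have hT : IsProjEquivariant (fullSymbol n mu ∘ₗ LinearMap.proj mu ∘ₗ F ∘ₗ quantDiff n lam) := by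
      intro Y hY S
      simp only [LinearMap.comp_apply, LinearMap.proj_apply]
      rw [← adDiff_quantDiff n lam hY, hF.equivariant Y hY]
      exact fullSymbol_adOp mu hY (hF' _ mu)
    exact hT.exists_scalar hd
  choose c hc using h
  refine ⟨fun k mu => c mu k, fun k hk S mu => ?_⟩
  rw [← quant_fullSymbol mu (hF' (quantDiff n lam (rankPart k S)) mu), hc, map_smul,
    quant_rankPart hk]

theorem pencilOp_apply_mem {d n : ℕ} {D : Pencil d} (hD : D ∈ pencilOp d n) (mu : ℝ) :
    D mu ∈ diffOp d n := by
  induction hD using Submodule.span_induction with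
  | mem D h =>
    obtain ⟨j, k, hjk, L, hL, rfl⟩ := h
    exact Submodule.smul_mem _ _ (diffOp_mono (by omega) hL)
  | zero => exact zero_mem _
  | add D E _ _ hD hE => exact add_mem hD hE
  | smul c D _ hD => exact Submodule.smul_mem _ c hD

/-- A linear functional that vanishes on operators of order `< k` is, on a pencil of order `≤ n`,
a polynomial in the weight of degree `≤ n - k`. -/
theorem exists_polynomial_of_pencilOp {d n k : ℕ} (hk : k ≤ n) (φ : Op d →ₗ[ℝ] ℝ)
    (hφ : ∀ m < k, ∀ L ∈ diffOp d m, φ L = 0) {D : Pencil d} (hD : D ∈ pencilOp d n) :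
    ∃ p : Polynomial ℝ, p.natDegree ≤ n - k ∧ ∀ mu, φ (D mu) = p.eval mu := by
  induction hD using Submodule.span_induction with
  | mem D h =>
    obtain ⟨j, m, hjm, L, hL, rfl⟩ := h
    -- A generator `μ^j L` with `L` of order `≤ m` is either killed by `φ` or has `m ≥ k`, and then
    -- `j ≤ n - k`.
    by_cases hm : m < k
    · exact ⟨0, by simp, fun mu => by rw [map_smul, hφ m hm L hL]; simp⟩
    · refine ⟨Polynomial.monomial j (φ L), (Polynomial.natDegree_monomial_le _).trans (by omega),
        fun mu => ?_⟩
      rw [map_smul, Polynomial.eval_monomial, smul_eq_mul, mul_comm]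
  | zero => exact ⟨0, by simp, fun mu => by simp⟩
  | add D E _ _ hD hE =>
    obtain ⟨p, hp, hp'⟩ := hD
    obtain ⟨q, hq, hq'⟩ := hE
    refine ⟨p + q, (Polynomial.natDegree_add_le p q).trans (max_le hp hq), fun mu => ?_⟩
    rw [Pi.add_apply, map_add, hp', hq', Polynomial.eval_add]
  | smul c D _ hD =>
    obtain ⟨p, hp, hp'⟩ := hD
    refine ⟨c • p, (Polynomial.natDegree_smul_le c p).trans hp, fun mu => ?_⟩
    rw [Pi.smul_apply, map_smul, hp', Polynomial.eval_smul]

/-- The scalar is recovered by a functional on a test symbol: the coefficient of `ξ_0^k` at the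
origin in the rank-`k` principal symbol. This functional ignores operators of order below `k`, which
gives the bound on the degree. -/
theorem exists_polynomial_of_lifting {d n k : ℕ} (hd : 0 < d) (hk : k ≤ n) {lam : ℝ}
    {F : LiftMap d n} (hF : IsRegularProjLifting d n lam F) {c : ℝ → ℝ}
    (hc : ∀ S mu, F (quantDiff n lam (rankPart k S)) mu = c mu • quantRank k mu S) :
    ∃ p : Polynomial ℝ, p.natDegree ≤ n - k ∧ ∀ mu, c mu = p.eval mu := by
  let α : Fin d →₀ ℕ := Finsupp.single ⟨0, hd⟩ k
  let φ : Op d →ₗ[ℝ] ℝ := coeffAt 0 α ∘ₗ prinSymbol k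
  have hφ : ∀ m < k, ∀ L ∈ diffOp d m, φ L = 0 := by
    intro m hm L hL
    obtain ⟨S, hS, rfl⟩ := exists_normalOrder_eq hL
    rw [LinearMap.comp_apply, prinSymbol_normalOrder, (totalDegree_le_iff_rankPart m S).1 hS k hm,
      map_zero]
  obtain ⟨p, hp, hp'⟩ := exists_polynomial_of_pencilOp hk φ hφ
    (hF.regular (quantDiff n lam (rankPart k (monomial α 1))))
  refine ⟨p, hp, fun mu => ?_⟩
  rw [← hp', hc, map_smul, LinearMap.comp_apply, prinSymbol_quantRank le_rfl, if_pos rfl,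
    rankPart_monomial, Finsupp.degree_single, if_pos rfl, coeffAt_apply, MvPolynomial.coeff_monomial,
    if_pos rfl, map_one, smul_eq_mul, mul_one]

theorem eq_one_of_lifting {d n k : ℕ} (hd : 0 < d) (hk : k ≤ n) {lam : ℝ}
    {F : LiftMap d n} (hF : IsRegularProjLifting d n lam F) {c : ℝ → ℝ}
    (hc : ∀ S mu, F (quantDiff n lam (rankPart k S)) mu = c mu • quantRank k mu S) :
    c lam = 1 := by
  by_contra hne
  refine rankPart_ne_zero hd k ?_
  generalize (monomial (Finsupp.single (⟨0, hd⟩ : Fin d) k) (1 : Smooth d)) = R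
  have h := hc R lam
  rw [hF.passes, coe_quantDiff, quant_rankPart hk] at h
  have h1 := congrArg (prinSymbol k) h
  rw [map_smul, prinSymbol_quantRank le_rfl, if_pos rfl] at h1
  have h2 : (c lam - 1) • rankPart k R = 0 := by rw [sub_smul, one_smul, ← h1, sub_self]
  exact (smul_eq_zero.1 h2).resolve_left (sub_ne_zero.2 hne)

theorem exists_dressed_eq {d n : ℕ} (hd : 0 < d) {lam : ℝ} {F : LiftMap d n}
    (hF : IsRegularProjLifting d n lam F) :
    ∃ a : Matrix (Fin (n + 1)) (Fin (n + 1)) ℝ, IsAdmissible lam a ∧ F = dressed d lam a := by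
  obtain ⟨c, hc⟩ := exists_quantRank_of_lifting hd hF
    fun L mu => pencilOp_apply_mem (hF.regular L) mu
  choose p hp hp' using fun i : Fin (n + 1) =>
    exists_polynomial_of_lifting hd (Nat.sub_le n i) hF (hc (n - i) (Nat.sub_le n i))
  have hdeg : ∀ i : Fin (n + 1), (p i).natDegree ≤ i := fun i => (hp i).trans (by omega)
  -- Row `i` lists the coefficients of the scalar on rank `n - i`; passing through `Δ` at `λ`
  -- normalises the rows to `P_i(λ) = 1`.
  let a : Matrix (Fin (n + 1)) (Fin (n + 1)) ℝ := fun i j => (p i).coeff j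
  have hrow : ∀ i mu, rowPoly a i mu = c (n - i) mu := by
    intro i mu
    rw [hp' i mu, Polynomial.eval_eq_sum_range' (Nat.lt_succ_of_le ((hdeg i).trans i.is_le)),
      Finset.sum_range]
    rfl
  have hone : ∀ i, rowPoly a i lam = 1 := fun i => by
    rw [hrow, eq_one_of_lifting hd (Nat.sub_le n i) hF (hc (n - i) (Nat.sub_le n i))]
  have ha : IsAdmissible lam a := by
    refine ⟨fun i j hij => ?_, fun i => ?_, fun i => by rw [hone]; exact one_ne_zero⟩
    · exact Polynomial.coeff_eq_zero_of_natDegree_lt ((hdeg i).trans_lt hij)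
    · by_contra hz
      push Not at hz
      have := hone i
      rw [rowPoly, Finset.sum_eq_zero fun j _ => by rw [hz j, zero_mul]] at this
      exact zero_ne_one this
  refine ⟨a, ha, linearMap_ext_quantDiff lam fun k hk S => funext fun mu => ?_⟩
  rw [dressed_quantDiff hk, hc k hk, hone, hrow, div_one]
  congr 2
  simp only
  omega

/-! ### Parametrisation by products of projective spaces -/

theorem coeff_rowPolynomial {n : ℕ} (a : Matrix (Fin (n + 1)) (Fin (n + 1)) ℝ) (i j : Fin (n + 1)) :
    (rowPolynomial a i).coeff j = a i j := by
  rw [rowPolynomial, Polynomial.finsetSum_coeff, Finset.sum_eq_single j]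
  · rw [Polynomial.coeff_monomial, if_pos rfl]
  · intro l _ hl
    rw [Polynomial.coeff_monomial, if_neg fun h => hl (Fin.ext h)]
  · simp

theorem dressed_eq_iff {d n : ℕ} (hd : 0 < d) (lam : ℝ)
    (a b : Matrix (Fin (n + 1)) (Fin (n + 1)) ℝ) :
    dressed d lam a = dressed d lam b ↔
      ∀ i mu, rowPoly a i mu / rowPoly a i lam = rowPoly b i mu / rowPoly b i lam := by
  constructor
  · intro h i mu
    by_contra hne
    refine rankPart_ne_zero hd (n - i) ?_
    generalize (monomial (Finsupp.single (⟨0, hd⟩ : Fin d) (n - i)) (1 : Smooth d)) = R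
    have h1 := congrArg (prinSymbol (n - i))
      (congrFun (LinearMap.congr_fun h (quantDiff n lam (rankPart (n - i) R))) mu)
    have hi : (⟨n - (n - i), by omega⟩ : Fin (n + 1)) = i := Fin.ext (by simp only; omega)
    rw [dressed_quantDiff (Nat.sub_le n i), dressed_quantDiff (Nat.sub_le n i), map_smul, map_smul,
      prinSymbol_quantRank le_rfl, if_pos rfl, hi, ← sub_eq_zero, ← sub_smul] at h1
    exact (smul_eq_zero.1 h1).resolve_left (sub_ne_zero.2 hne)
  · intro h
    refine linearMap_ext_quantDiff lam fun k hk S => funext fun mu => ?_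
    rw [dressed_quantDiff hk, dressed_quantDiff hk, h]

/-- The right-hand side is the one in `dressed_eq_iff`: equality of points and equality of liftings
are the same relation on admissible matrices. -/
theorem toParam_eq_iff {n : ℕ} {lam : ℝ} {a b : Matrix (Fin (n + 1)) (Fin (n + 1)) ℝ}
    (ha : IsAdmissible lam a) (hb : IsAdmissible lam b) :
    toParam a ha = toParam b hb ↔
      ∀ i mu, rowPoly a i mu / rowPoly a i lam = rowPoly b i mu / rowPoly b i lam := by
  have hmk : toParam a ha = toParam b hb ↔ ∀ i, ∃ c : ℝ, c • rowVec b i = rowVec a i := by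
    refine Subtype.ext_iff.trans (funext_iff.trans (forall_congr' fun i => ?_))
    exact Projectivization.mk_eq_mk_iff' ℝ _ _ _ _
  rw [hmk]
  constructor
  · intro h i mu
    induction i using Fin.cases with
    -- The top row has a single possibly nonzero entry, so its ratio is always `1`; this is why it
    -- contributes no parameter.
    | zero =>
      have h0 : ∀ (e : Matrix (Fin (n + 1)) (Fin (n + 1)) ℝ), IsAdmissible lam e →
          rowPoly e 0 mu / rowPoly e 0 lam = 1 := by
        intro e he
        have : ∀ t, rowPoly e 0 t = e 0 0 := fun t => by
          rw [rowPoly, Finset.sum_eq_single 0]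
          · simp
          · intro j _ hj
            rw [he.lower 0 j (Fin.pos_iff_ne_zero.2 hj), zero_mul]
          · simp
        rw [this mu, ← this lam, div_self (he.denom_ne 0)]
      rw [h0 a ha, h0 b hb]
    | succ i =>
      obtain ⟨c, hc⟩ := h i
      have h1 : ∀ t, rowPoly a i.succ t = c * rowPoly b i.succ t := fun t => by
        rw [rowPoly_succ ha, rowPoly_succ hb, ← hc, Finset.mul_sum]
        exact Finset.sum_congr rfl fun j _ => mul_assoc _ _ _
      have hc0 : c ≠ 0 := fun h0 => ha.denom_ne i.succ (by rw [h1, h0, zero_mul])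
      rw [h1, h1, mul_div_mul_left _ _ hc0]
  · intro h i
    -- The factor is forced by evaluation at `λ`. Equal polynomial functions on `ℝ` have equal
    -- coefficients, so the rows are proportional.
    refine ⟨rowPoly a i.succ lam / rowPoly b i.succ lam, funext fun j => ?_⟩
    have hp : rowPolynomial a i.succ
        = (rowPoly a i.succ lam / rowPoly b i.succ lam) • rowPolynomial b i.succ := by
      refine Polynomial.funext fun t => ?_
      rw [Polynomial.eval_smul, eval_rowPolynomial, eval_rowPolynomial, smul_eq_mul,
        div_mul_eq_mul_div, eq_div_iff (hb.denom_ne _)]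
      have := h i.succ t
      rw [div_eq_div_iff (ha.denom_ne _) (hb.denom_ne _)] at this
      rw [this, mul_comm]
    have hj := congrArg (fun p => p.coeff (Fin.castLE (by omega : (i : ℕ) + 2 ≤ n + 1) j)) hp
    simp only [Polynomial.coeff_smul, coeff_rowPolynomial] at hj
    exact hj.symm

/-- The matrix with given rows below the top one. -/
def matrixOfRows {n : ℕ} (v : (i : Fin n) → Fin ((i : ℕ) + 2) → ℝ) :
    Matrix (Fin (n + 1)) (Fin (n + 1)) ℝ :=
  -- Any nonzero corner entry would do for the top row.
  Fin.cons (Pi.single 0 1) fun i j => if h : (j : ℕ) < (i : ℕ) + 2 then v i ⟨j, h⟩ else 0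

theorem rowVec_matrixOfRows {n : ℕ} (v : (i : Fin n) → Fin ((i : ℕ) + 2) → ℝ) (i : Fin n) :
    rowVec (matrixOfRows v) i = v i := by
  funext j
  have hj : ((Fin.castLE (by omega : (i : ℕ) + 2 ≤ n + 1) j : Fin (n + 1)) : ℕ) < (i : ℕ) + 2 := j.2
  rw [rowVec, matrixOfRows, Fin.cons_succ, dif_pos hj]
  rfl

theorem isAdmissible_matrixOfRows {n : ℕ} {lam : ℝ} (v : (i : Fin n) → Fin ((i : ℕ) + 2) → ℝ)
    (hv : ∀ i, ∑ j, v i j * lam ^ (j : ℕ) ≠ 0) : IsAdmissible lam (matrixOfRows v) := by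
  have hzero : rowPoly (matrixOfRows v) 0 lam = 1 := by
    rw [rowPoly, Finset.sum_eq_single 0]
    · simp [matrixOfRows]
    · intro j _ hj
      simp [matrixOfRows, hj]
    · simp
  have hsucc : ∀ i : Fin n, rowPoly (matrixOfRows v) i.succ lam = ∑ j, v i j * lam ^ (j : ℕ) := by
    intro i
    have hle : (i : ℕ) + 2 ≤ n + 1 := by omega
    refine (Finset.sum_of_injOn (Fin.castLE hle) (Fin.castLE_injective hle).injOn
      (fun _ _ => Finset.mem_coe.2 (Finset.mem_univ _)) ?_ ?_).symm
    · intro j _ hj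
      have : ¬ (j : ℕ) < (i : ℕ) + 2 := fun h =>
        hj ⟨⟨j, h⟩, Finset.mem_coe.2 (Finset.mem_univ _), Fin.ext rfl⟩
      rw [matrixOfRows, Fin.cons_succ, dif_neg this, zero_mul]
    · intro j _
      rw [← rowVec_matrixOfRows v i]; rfl
  have hne : ∀ i, rowPoly (matrixOfRows v) i lam ≠ 0 := by
    intro i
    induction i using Fin.cases with
    | zero => rw [hzero]; exact one_ne_zero
    | succ i => rw [hsucc]; exact hv i
  refine ⟨fun i j hij => ?_, fun i => ?_, hne⟩
  · induction i using Fin.cases with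
    | zero => simp [matrixOfRows, hij.ne']
    | succ i =>
      have : ¬ (j : ℕ) < (i : ℕ) + 2 := by
        have : (i : ℕ) + 1 < j := hij
        omega
      rw [matrixOfRows, Fin.cons_succ, dif_neg this]
  · by_contra hz
    push Not at hz
    refine hne i ?_
    rw [rowPoly]
    exact Finset.sum_eq_zero fun j _ => by rw [hz j, zero_mul]

/-- The lifting attached to a point of the product of projective spaces. -/
def liftingOfParam (d : ℕ) {n : ℕ} {lam : ℝ} (p : Param n lam) :
    {F : LiftMap d n // IsRegularProjLifting d n lam F} :=
  ⟨dressed d lam (matrixOfRows fun i => (p.1 i).rep),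
    isRegularProjLifting_dressed d (isAdmissible_matrixOfRows _ p.2)⟩

theorem toParam_matrixOfRows {n : ℕ} {lam : ℝ} (p : Param n lam) :
    toParam (matrixOfRows fun i => (p.1 i).rep) (isAdmissible_matrixOfRows _ p.2) = p := by
  refine Subtype.ext (funext fun i => ?_)
  change Projectivization.mk ℝ (rowVec (matrixOfRows fun i => (p.1 i).rep) i) _ = p.1 i
  conv_rhs => rw [← Projectivization.mk_rep (p.1 i)]
  congr 1
  exact rowVec_matrixOfRows _ i

theorem liftingOfParam_toParam {d n : ℕ} (hd : 0 < d) {lam : ℝ}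
    (a : Matrix (Fin (n + 1)) (Fin (n + 1)) ℝ) (ha : IsAdmissible lam a) :
    (liftingOfParam d (toParam a ha)).1 = dressed d lam a :=
  (dressed_eq_iff hd lam _ _).2
    ((toParam_eq_iff (isAdmissible_matrixOfRows _ (toParam a ha).2) ha).1
      (toParam_matrixOfRows (toParam a ha)))

/-- `toParam` and `dressed` are both onto and identify the same pairs of admissible matrices, so the
induced map is a bijection. -/
theorem bijective_liftingOfParam {d : ℕ} (hd : 0 < d) (n : ℕ) (lam : ℝ) :
    Function.Bijective (liftingOfParam d : Param n lam → _) := by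
  constructor
  · intro p q h
    rw [← toParam_matrixOfRows p, ← toParam_matrixOfRows q, toParam_eq_iff, ← dressed_eq_iff hd]
    exact congrArg Subtype.val h
  · rintro ⟨F, hF⟩
    obtain ⟨a, ha, rfl⟩ := exists_dressed_eq hd hF
    exact ⟨toParam a ha, Subtype.ext (liftingOfParam_toParam hd a ha)⟩

end

end ProjPencil

theorem mainTheorem4 (d n : ℕ) (hd : 0 < d) (lam : ℝ) :
    -- for every weight `mu`, `fullSymbol n mu` is the unique `proj`-equivariant full symbol map,
    -- and `quant n mu` is its inverse
    (∀ mu : ℝ,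
      (∀ σ : ProjPencil.diffOp d n →ₗ[ℝ] ProjPencil.Sym d,
        ProjPencil.IsProjFullSymbol d n mu σ ↔
          σ = ProjPencil.fullSymbol n mu ∘ₗ (ProjPencil.diffOp d n).subtype) ∧
      (∀ L ∈ ProjPencil.diffOp d n,
        ProjPencil.quant n mu (ProjPencil.fullSymbol n mu L) = L) ∧
      (∀ S : ProjPencil.Sym d, S.totalDegree ≤ n →
        ProjPencil.quant n mu S ∈ ProjPencil.diffOp d n ∧
          ProjPencil.fullSymbol n mu (ProjPencil.quant n mu S) = S)) ∧
    -- every dressed lifting is a regular `proj`-equivariant pencil lifting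
    (∀ a : Matrix (Fin (n + 1)) (Fin (n + 1)) ℝ, ProjPencil.IsAdmissible lam a →
      ProjPencil.IsRegularProjLifting d n lam (ProjPencil.dressed d lam a)) ∧
    -- every regular `proj`-equivariant pencil lifting is a dressed lifting
    (∀ F : ProjPencil.LiftMap d n, ProjPencil.IsRegularProjLifting d n lam F →
      ∃ a : Matrix (Fin (n + 1)) (Fin (n + 1)) ℝ, ProjPencil.IsAdmissible lam a ∧
        F = ProjPencil.dressed d lam a) ∧
    -- the classes of the rows parametrise these liftings bijectively
    (∃ Φ : ProjPencil.Param n lam ≃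
        {F : ProjPencil.LiftMap d n // ProjPencil.IsRegularProjLifting d n lam F},
      ∀ (a : Matrix (Fin (n + 1)) (Fin (n + 1)) ℝ) (ha : ProjPencil.IsAdmissible lam a),
        (Φ (ProjPencil.toParam a ha)).1 = ProjPencil.dressed d lam a) := by
  refine ⟨fun mu => ⟨ProjPencil.isProjFullSymbol_iff hd mu,
      fun L hL => ProjPencil.quant_fullSymbol mu hL,
      fun S hS => ⟨ProjPencil.quant_mem n mu S, ProjPencil.fullSymbol_quant mu hS⟩⟩,
    fun a ha => ProjPencil.isRegularProjLifting_dressed d ha,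
    fun F hF => ProjPencil.exists_dressed_eq hd hF,
    Equiv.ofBijective _ (ProjPencil.bijective_liftingOfParam hd n lam),
    fun a ha => ProjPencil.liftingOfParam_toParam hd a ha⟩
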